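/- **Setting.** Let $M=M^{(N)}$, $N\ge 1$, be Hermitian random $N\times N$ matrices whose entries have moments of all orders, such that: * (local $U(1)$-invariance) for all real angles, $(e^{-i\theta_i}M_{ij}e^{i\theta_j})_{i,j}$ has the same law as $M$; * (loops) for each $n\ge1$, $\mathbb E[M_{i_1i_2}M_{i_2i_3}\cdots M_{i_ni_1}]=O(N^{1-n})$ uniformly over pairwise distinct indices; * (factorization) for all $m,n\ge1$, uniformly over distinct $i_1,\dots,i_m$ and distinct $j_1,\dots,j_n$ with no common index except possibly $i_1=j_1$, $$\mathbb E[M_{i_1i_2}\cdots M_{i_mi_1}M_{j_1j_2}\cdots M_{j_nj_1}]=\mathbb E[M_{i_1i_2}\cdots M_{i_mi_1}]\,\mathbb E[M_{j_1j_2}\cdots M_{j_nj_1}]+O(N^{1-m-n});$$ * (local free cumulants) for each $n\ge1$ there is a continuous $g_n:[0,1]^n\to\mathbb C$ such that the joint cumulant of the entries satisfies $N^{n-1}\,\mathbb E[M_{i_1i_2}M_{i_2i_3}\cdots M_{i_ni_1}]^c-g_n(i_1/N,\dots,i_n/N)\to0$, uniformly over pairwise distinct indices. A *profile* is a bounded measurable,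 almost everywhere continuous function $h:[0,1]\to\mathbb R$; it also denotes the diagonal matrix with entries $h(i/N)$. For a profile $h\ge0$ let $M_h=h^{1/2}Mh^{1/2}$. Its (limiting) spectral measure is a measure $\sigma_I$ with $\int\lambda^k\,d\sigma_I=\lim_N\mathbb E\,\frac1N\mathrm{tr}(M_h^k)$ for all $k\ge 0$; let $\sigma$ be that of $M$ (the case $h=1$), and let $\nu$ be the law of $h$ under Lebesgue measure on $[0,1]$. Write $[f]=\int_0^1f(x)\,dx$, $[[f]]=\int_0^1\!\int_0^1 f(x,y)\,dx\,dy$ and $(h\times h)(x,y)=h(x)h(y)$. For a measure $\mu$ with moments $m_n$ and $m_1\neq0$, $1/z_\mu(w)$ denotes the formal power series in $w$ without constant term that solves $\sum_{n\ge1}m_n z^{-n}=w$ (i.e. $zG_\mu(z)=w+1$), and $S_\mu(w)=\frac{w+1}{w\,z_\mu(w)}$ is the $S$-transform. Put $z_0=z_\sigma$, $z_I=z_{\sigma_I}$, $S_0=S_\sigma$, $S_I=S_{\sigma_I}$, $S_h=S_\nu$. The free multiplicative convolution $\nu\boxtimes\sigma$ is the distribution (in the sense of moments) of $ba$ for free elements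 $b,a$ with distributions $\nu,\sigma$. $M$ is free from a family of profiles if all joint moments of $M$ and these diagonal matrices under $\mathbb E\,\frac1N\mathrm{tr}$ converge as $N\to\infty$ to those of a noncommutative random variable $a$ and a family free from $a$. **Theorem.** 1. Let $h\ge0$ be a profile with $[g_1]\ne0$ and $[hg_1]\neq0$, and let $M$ and $M_h$ have spectral measures $\sigma$ and $\sigma_I$. Then the above series exist and are unique, and, as formal power series in $w$, $$\frac{z_0}{z_I}=\frac{[g_1]}{[hg_1]}\left(1-\Big(\frac{[(hg_1)^2]}{[hg_1]^2}-\frac{[g_1^2]}{[g_1]^2}\Big)w-\Big(\frac{[[g_2\,(h\times h)]]}{[hg_1]^2}-\frac{[[g_2]]}{[g_1]^2}\Big)w+O(w^2)\right).$$ Moreover $S_I=S_hS_0$ if and only if $z_0/z_I=S_h$; and $S_I=S_hS_0$ forces both $[hg_1]=[h][g_1]$ and $$\Big(\frac{[(hg_1)^2]}{[hg_1]^2}-\frac{[g_1^2]}{[g_1]^2}\Big)+\Big(\frac{[[g_2(h\times h)]]}{[hg_1]^2}-\frac{[[g_2]]}{[g_1]^2}\Big)=\frac{[h^2]-[h]^2}{[h]^2}.$$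 2. If for some $n\ge1$ the symmetrization of $g_n$, $\frac1{n!}\sum_{\tau}g_n(x_{\tau(1)},\dots,x_{\tau(n)})$, is not constant on $[0,1]^n$, then there is a profile $h\ge0$ such that the spectral measure $\sigma_I$ of $h^{1/2}Mh^{1/2}$ is not the free multiplicative convolution $\nu\boxtimes\sigma$ of the spectral measures of $h$ and $M$ (no limiting spectral measures $\sigma$ of $M$ and $\sigma_I$ of $M_h$ satisfy $\sigma_I=\nu\boxtimes\sigma$), and $M$ is not free from $h$. 3. If for some $n\ge1$ the function $g_n$ is not constant on $[0,1]^n$, then $M$ is not free from the deterministic diagonal matrices (the family of all profiles). -/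

import Mathlib

open MeasureTheory Filter Topology
open scoped PowerSeries

noncomputable section

namespace StructuredRM

/-! ### Random matrix ensembles

The law of a random `N × N` complex matrix is a probability measure on `Fin N → Fin N → ℂ`.
The index `i : Fin N` stands for the site `i + 1` of `{1, …, N}`, at position `(i + 1) / N`. -/

/-- The point of `[0, 1]` attached to the index `i`. -/
def site (N : ℕ) (i : Fin N) : ℝ := ((i : ℝ) + 1) / N

/-- The factors `M_{i₁ i₂}, M_{i₂ i₃}, …, M_{iₙ i₁}` of a loop. -/
def loopEntry {N n : ℕ} (i : Fin n → Fin N) (k : Fin n) (A : Fin N → Fin N → ℂ) : ℂ :=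
  A (i k) (i (finRotate n k))

/-- The loop `M_{i₁ i₂} M_{i₂ i₃} ⋯ M_{iₙ i₁}`. -/
def loop {N n : ℕ} (i : Fin n → Fin N) (A : Fin N → Fin N → ℂ) : ℂ :=
  ∏ k, loopEntry i k A

/-- The joint (classical) cumulant of the random variables `X 0, …, X (n - 1)` under `μ`:
`∑_π (-1)^(|π| - 1) (|π| - 1)! ∏_{B ∈ π} 𝔼[∏_{b ∈ B} X b]`, over the set partitions `π`. -/
def jointCumulant {Ω : Type*} [MeasurableSpace Ω] (μ : Measure Ω) {n : ℕ}
    (X : Fin n → Ω → ℂ) : ℂ :=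
  ∑ π : Finpartition (Finset.univ : Finset (Fin n)),
    (-1 : ℂ) ^ (π.parts.card - 1) * ((π.parts.card - 1).factorial : ℂ) *
      ∏ B ∈ π.parts, ∫ ω, ∏ b ∈ B, X b ω ∂μ

/-- `P N` is the law of the Hermitian random matrix `M` of size `N`, and the ensemble satisfies
the three defining properties, with local free cumulants `g n`, `n ≥ 1`. -/
structure IsEnsemble (P : ∀ N : ℕ, Measure (Fin N → Fin N → ℂ))
    (g : ∀ n : ℕ, (Fin n → ℝ) → ℂ) : Prop where
  prob : ∀ N, IsProbabilityMeasure (P N)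
  herm : ∀ N, ∀ᵐ A ∂P N, (Matrix.of A).IsHermitian
  /-- the entries have moments of all orders -/
  moments : ∀ N (p : ℕ) (i j : Fin N), MemLp (fun A => A i j) p (P N)
  /-- local `U(1)`-invariance of the law of the matrix -/
  invariance : ∀ N (θ : Fin N → ℝ),
    (P N).map (fun A i j =>
      Complex.exp (-(Complex.I * θ i)) * A i j * Complex.exp (Complex.I * θ j)) = P N
  /-- loops without repeated indices have expectation `O(N^(1-n))` -/
  loop_bound : ∀ n, 1 ≤ n → ∃ C : ℝ, ∀ N (i : Fin n → Fin N), Function.Injective i →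
    (N : ℝ) ^ (n - 1) * ‖∫ A, loop i A ∂P N‖ ≤ C
  /-- the expectation of a product of two loops, of generic order
  `N^(1-m) N^(1-n)`, factorizes up to a relative error `O(N⁻¹)`, even if the two loops start
  at the same index -/
  factorization : ∀ m n, 1 ≤ m → 1 ≤ n → ∃ C : ℝ, ∀ N (i : Fin m → Fin N) (j : Fin n → Fin N),
    Function.Injective i → Function.Injective j →
    (∀ a b, i a = j b → (a : ℕ) = 0 ∧ (b : ℕ) = 0) →
    (N : ℝ) ^ (m + n - 1) *
      ‖∫ A, loop i A * loop j A ∂P N - (∫ A, loop i A ∂P N) * ∫ A, loop j A ∂P N‖ ≤ C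
  continuous : ∀ n, 1 ≤ n → ContinuousOn (g n) (Set.Icc 0 1)
  /-- `g n (x₁, …, xₙ) = lim N^(n-1) 𝔼[M_{i₁ i₂} ⋯ M_{iₙ i₁}]^c` with `x_k = i_k / N`, the
  indices being distinct -/
  limit : ∀ n, 1 ≤ n → ∀ ε : ℝ, 0 < ε → ∀ᶠ N in atTop, ∀ i : Fin n → Fin N,
    Function.Injective i →
    ‖(N : ℂ) ^ (n - 1) * jointCumulant (P N) (loopEntry i) - g n (fun k => site N (i k))‖ < ε

/-- The symmetrization of `f` over all permutations of its arguments. -/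
def symmetrize {n : ℕ} (f : (Fin n → ℝ) → ℂ) (x : Fin n → ℝ) : ℂ :=
  (n.factorial : ℂ)⁻¹ * ∑ τ : Equiv.Perm (Fin n), f (fun k => x (τ k))

/-- `f` takes a single value on `[0, 1]ⁿ`. -/
def IsConstOnCube {n : ℕ} (f : (Fin n → ℝ) → ℂ) : Prop :=
  ∃ c : ℂ, ∀ x ∈ Set.Icc (0 : Fin n → ℝ) 1, f x = c

/-! ### Deterministic diagonal matrices and spectral measures -/

/-- Functions on `[0, 1]` that define deterministic bounded diagonal matrices
`diag (h (1/N), …, h (N/N))` with a macroscopic limit: bounded and almost everywhere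
continuous, that is, Riemann integrable. -/
structure IsProfile (h : ℝ → ℝ) : Prop where
  measurable : Measurable h
  bounded : ∃ C : ℝ, ∀ x ∈ Set.Icc (0 : ℝ) 1, |h x| ≤ C
  ae_continuous : ∀ᵐ x ∂(volume.restrict (Set.Icc (0 : ℝ) 1)),
    ContinuousWithinAt h (Set.Icc 0 1) x

/-- Nonnegative profiles, for which `h^{1/2}` makes sense. -/
def IsNonnegProfile (h : ℝ → ℝ) : Prop :=
  IsProfile h ∧ ∀ x ∈ Set.Icc (0 : ℝ) 1, 0 ≤ h x

/-- The deterministic diagonal matrix of size `N` with entries `h (i / N)`. -/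
def diagMat (N : ℕ) (h : ℝ → ℝ) : Matrix (Fin N) (Fin N) ℂ :=
  Matrix.diagonal fun i => (h (site N i) : ℂ)

/-- `M_h = h^{1/2} M h^{1/2}`. -/
def compressed {N : ℕ} (h : ℝ → ℝ) (A : Fin N → Fin N → ℂ) : Matrix (Fin N) (Fin N) ℂ :=
  diagMat N (fun x => √(h x)) * Matrix.of A * diagMat N (fun x => √(h x))

/-- The normalized trace `tr / N`. -/
def ntr {N : ℕ} (B : Matrix (Fin N) (Fin N) ℂ) : ℂ := (N : ℂ)⁻¹ * B.trace

/-- `μ` is the large `N` limit (in moments) of the spectral measure of `M_h`: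
`lim 𝔼 (tr / N) (M_h)^k = ∫ λ^k dμ(λ)` for all `k`. -/
def IsSpectralMeasure (P : ∀ N : ℕ, Measure (Fin N → Fin N → ℂ)) (h : ℝ → ℝ)
    (μ : Measure ℝ) : Prop :=
  ∀ k : ℕ, Integrable (fun t : ℝ => t ^ k) μ ∧
    Tendsto (fun N => ∫ A, ntr (compressed h A ^ k) ∂P N) atTop
      (𝓝 ((∫ t, t ^ k ∂μ : ℝ) : ℂ))

/-- The spectral measure `ν` of the diagonal matrix `h`: the law of `h` under Lebesgue measure
on `[0, 1]`. -/
def profileLaw (h : ℝ → ℝ) : Measure ℝ :=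
  (volume.restrict (Set.Icc (0 : ℝ) 1)).map h

/-! ### Free probability -/

/-- Subalgebras `A₁, A₂` are free with respect to `φ`: an alternating product of centred
elements is centred. -/
def AreFree {A : Type*} [Ring A] [Algebra ℂ A] (φ : A →ₗ[ℂ] ℂ) (A₁ A₂ : Subalgebra ℂ A) :
    Prop :=
  ∀ (n : ℕ) (c : Fin (n + 1) → Bool) (x : Fin (n + 1) → A),
    (∀ k : Fin n, c k.castSucc ≠ c k.succ) →
    (∀ k, x k ∈ (if c k then A₁ else A₂)) →
    (∀ k, φ (x k) = 0) →
    φ (List.ofFn x).prod = 0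

/-- The element `a` of the noncommutative probability space `(A, φ)` has distribution `μ`. -/
def HasDistribution {A : Type*} [Ring A] [Algebra ℂ A] (φ : A →ₗ[ℂ] ℂ) (a : A)
    (μ : Measure ℝ) : Prop :=
  ∀ k : ℕ, Integrable (fun t : ℝ => t ^ k) μ ∧ φ (a ^ k) = ((∫ t, t ^ k ∂μ : ℝ) : ℂ)

/-- `μ = ν ⊠ σ`: `μ` is the distribution of the product `b a` (equivalently, of
`b^{1/2} a b^{1/2}`) of free elements `b`, `a` with distributions `ν`, `σ`. -/
def IsFreeMulConv (ν σ μ : Measure ℝ) : Prop :=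
  ∃ (A : Type) (_ : Ring A) (_ : Algebra ℂ A) (φ : A →ₗ[ℂ] ℂ) (b a : A),
    φ 1 = 1 ∧
    AreFree φ (Algebra.adjoin ℂ {b}) (Algebra.adjoin ℂ {a}) ∧
    HasDistribution φ b ν ∧ HasDistribution φ a σ ∧ HasDistribution φ (b * a) μ

/-- The random matrix `M` (letter `none`) or one of the deterministic diagonal matrices
(letter `some d`). -/
def letterMat {T : Set (ℝ → ℝ)} {N : ℕ} (A : Fin N → Fin N → ℂ) :
    Option T → Matrix (Fin N) (Fin N) ℂ
  | none => Matrix.of A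
  | some d => diagMat N d.1

/-- `M` is (asymptotically, as `N → ∞`) free from the family `T` of deterministic diagonal
matrices: all joint moments `𝔼 (tr / N)` converge to those of an element `a` and a family
`ι d`, `d ∈ T`, such that `a` is free from the family. -/
def IsFreeFromDiagonal (P : ∀ N : ℕ, Measure (Fin N → Fin N → ℂ)) (T : Set (ℝ → ℝ)) : Prop :=
  ∃ (A : Type) (_ : Ring A) (_ : Algebra ℂ A) (φ : A →ₗ[ℂ] ℂ) (a : A) (ι : T → A),
    φ 1 = 1 ∧
    AreFree φ (Algebra.adjoin ℂ {a}) (Algebra.adjoin ℂ (Set.range ι)) ∧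
    ∀ w : List (Option T),
      Tendsto (fun N => ∫ X : Fin N → Fin N → ℂ, ntr (w.map (letterMat X)).prod ∂P N) atTop
        (𝓝 (φ (w.map fun o => o.elim a ι).prod))

/-! ### The formal series `1 / z(w)` and the `S`-transform -/

/-- With `u = 1 / z`, the formal power series `z G_μ(z) - 1 = ∑_{n ≥ 1} m_n(μ) u^n`. -/
def momentSeries (μ : Measure ℝ) : ℂ⟦X⟧ :=
  PowerSeries.mk fun n => if n = 0 then 0 else ((∫ t, t ^ n ∂μ : ℝ) : ℂ)

/-- `u` is the formal power series `1 / z(w)`, where `z = z(w)` solves `z G_μ(z) = w + 1`. -/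
def IsInvZ (μ : Measure ℝ) (u : ℂ⟦X⟧) : Prop :=
  PowerSeries.constantCoeff u = 0 ∧ PowerSeries.subst u (momentSeries μ) = PowerSeries.X

/-- `S` is the `S`-transform of `μ`: `S(w) = (w + 1) / (w z(w))`. -/
def IsSTransform (μ : Measure ℝ) (S : ℂ⟦X⟧) : Prop :=
  ∃ u, IsInvZ μ u ∧ PowerSeries.X * S = (1 + PowerSeries.X) * u

/-! ### The integrals that enter the expansion -/

/-- `[h g₁]` -/
def mean₁ (g : ∀ n : ℕ, (Fin n → ℝ) → ℂ) (h : ℝ → ℝ) : ℂ :=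
  ∫ x in (0 : ℝ)..1, (h x : ℂ) * g 1 ![x]

/-- `[(h g₁)²]` -/
def meanSq₁ (g : ∀ n : ℕ, (Fin n → ℝ) → ℂ) (h : ℝ → ℝ) : ℂ :=
  ∫ x in (0 : ℝ)..1, ((h x : ℂ) * g 1 ![x]) ^ 2

/-- `[[g₂ (h × h)]]` -/
def mean₂ (g : ∀ n : ℕ, (Fin n → ℝ) → ℂ) (h : ℝ → ℝ) : ℂ :=
  ∫ x in (0 : ℝ)..1, ∫ y in (0 : ℝ)..1, g 2 ![x, y] * (h x : ℂ) * (h y : ℂ)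

end StructuredRM

end

open StructuredRM

noncomputable section

namespace StructuredRM

/-! ### Formal inversion of power series -/

/-! The expansion in part 1 only involves two moments of `M_h`. Since the trace is cyclic, `h^{1/2}
M h^{1/2}` can be replaced by `h M`, and moments become sums over closed paths of indices. The first
moment tends to `[h g₁]`. In the second, the paths with two equal indices give `[(h g₁)²]` because
factorization yields `𝔼[M_ii²] ≈ g₁²`, and those with distinct indices give `[[g₂ (h × h)]]`
(`tendsto_wordMoment_two`). Inverting the moment series gives `1/z = w/m₁ - (m₂/m₁³) w² + ⋯`, and
the claims about `z₀/z_I` and the `S`-transforms follow by comparing two coefficients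
(`exists_series_quotient`).

For part 2, let `h` be a sum of indicators of disjoint intervals of length `2δ` centered at some of
the distinct points `x_1, …, x_n`. This is a projection. If it behaved as if free from `M`, the
`n`-th moment of `M_h` would be a polynomial `f` of degree at most `n` in the trace of `h`,
depending only on the moments of `M` (`exists_poly_moment`). An alternating sum over the subsets of
the intervals keeps exactly the words in which every interval occurs once. Such words only see loops
with distinct indices near the `x_k`, where moments and cumulants agree by `U(1)`-invariance, so the
sum is about `n! (2δ)^n` times the symmetrization of `g_n` at `x` (`wordMoment_bump`). The same
operation on `f` gives `n! (2δ)^n` times its coefficient of degree `n`. Hence the symmetrization is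
constant at generic points, and everywhere by continuity (`symmetrize_const`).

For part 3, let `p_c` be the indicator of a small interval around `c`. The difference `p_s - p_t` is
centered and is annihilated by the other `p_{x_k}`, so freeness kills `φ((p_s - p_t) a p_{x_1} a ⋯
p_{x_m} a)` (`orthogonal_word`). Therefore `g_{m+1}(s, x) = g_{m+1}(t, x)`. Since `g_{m+1}` is also
invariant under rotation of its arguments, it is constant (`const_of_free`). -/

theorem coeff_zero_mul' (f g : ℂ⟦X⟧) : PowerSeries.coeff 0 (f * g) =
    PowerSeries.coeff 0 f * PowerSeries.coeff 0 g := by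
  simp

theorem coeff_one_mul' (f g : ℂ⟦X⟧) : PowerSeries.coeff 1 (f * g) =
    PowerSeries.coeff 0 f * PowerSeries.coeff 1 g +
      PowerSeries.coeff 1 f * PowerSeries.coeff 0 g := by
  rw [PowerSeries.coeff_mul, Finset.Nat.sum_antidiagonal_eq_sum_range_succ_mk]
  simp [Finset.sum_range_succ]

theorem exists_subst_inverse (F : ℂ⟦X⟧) (h0 : PowerSeries.constantCoeff F = 0)
    (h1 : PowerSeries.coeff 1 F ≠ 0) :
    ∃ v : ℂ⟦X⟧, (∀ u : ℂ⟦X⟧, (PowerSeries.constantCoeff u = 0 ∧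
        PowerSeries.subst u F = PowerSeries.X) ↔ u = PowerSeries.X * v) ∧
      PowerSeries.coeff 0 v = (PowerSeries.coeff 1 F)⁻¹ ∧
      PowerSeries.coeff 1 v = -PowerSeries.coeff 2 F / PowerSeries.coeff 1 F ^ 3 := by
  have hunit : IsUnit (PowerSeries.coeff 1 F) := isUnit_iff_ne_zero.2 h1
  set u₀ := F.substInvOfIsUnit hunit with hu₀
  have hc : PowerSeries.constantCoeff u₀ = 0 :=
    PowerSeries.constantCoeff_substInvOfIsUnit F hunit
  have hr : PowerSeries.subst u₀ F = PowerSeries.X :=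
    PowerSeries.subst_substInvOfIsUnit_right F h0 hunit
  have hl : PowerSeries.subst F u₀ = PowerSeries.X :=
    PowerSeries.subst_substInvOfIsUnit_left F h0 hunit
  obtain ⟨v, hv⟩ : PowerSeries.X ∣ u₀ := PowerSeries.X_dvd_iff.2 hc
  have hsu : PowerSeries.HasSubst u₀ := PowerSeries.HasSubst.of_constantCoeff_zero' hc
  -- Write `F = X (c₁ + X (c₂ + X R))`, substitute `u₀ = X v` in `F(u₀) = X` and cancel one `X`. The
  -- first two coefficients of this identity determine those of `v`.
  have key : (1 : ℂ⟦X⟧) = v * (PowerSeries.C (PowerSeries.coeff 1 F) +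
      PowerSeries.X * v * (PowerSeries.C (PowerSeries.coeff 2 F) + PowerSeries.X * v *
        PowerSeries.subst u₀ (PowerSeries.mk fun n => PowerSeries.coeff (n + 3) F))) := by
    have hF : F = PowerSeries.X * (PowerSeries.C (PowerSeries.coeff 1 F) +
        PowerSeries.X * (PowerSeries.C (PowerSeries.coeff 2 F) + PowerSeries.X *
          (PowerSeries.mk fun n => PowerSeries.coeff (n + 3) F))) := by
      ext n
      rcases n with _ | _ | _ | n
      · simpa using h0
      · rw [PowerSeries.coeff_succ_X_mul]; simp
      · rw [PowerSeries.coeff_succ_X_mul, map_add, PowerSeries.coeff_succ_X_mul]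
        simp
      · rw [PowerSeries.coeff_succ_X_mul, map_add, PowerSeries.coeff_succ_X_mul, map_add,
          PowerSeries.coeff_succ_X_mul]
        simp
    have hsubst := hr
    rw [hF] at hsubst
    simp only [← PowerSeries.coe_substAlgHom hsu] at hsubst
    simp only [map_mul, map_add] at hsubst
    simp only [PowerSeries.coe_substAlgHom hsu, PowerSeries.subst_X hsu] at hsubst
    have hC : ∀ c : ℂ, PowerSeries.subst u₀ (PowerSeries.C c) = PowerSeries.C c := fun c =>
      PowerSeries.subst_C c
    rw [hC, hC, hv] at hsubst
    have hX : (PowerSeries.X : ℂ⟦X⟧) ≠ 0 := PowerSeries.X_ne_zero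
    apply mul_left_cancel₀ hX
    rw [hv, mul_one]
    conv_lhs => rw [← hsubst]
    ring
  have e0 := congrArg (PowerSeries.coeff 0) key
  have e1 := congrArg (PowerSeries.coeff 1) key
  simp only [mul_assoc] at e0 e1
  rw [coeff_zero_mul', map_add, PowerSeries.coeff_zero_X_mul] at e0
  rw [coeff_one_mul', map_add, map_add, PowerSeries.coeff_zero_X_mul, show (1 : ℕ) = 0 + 1 from rfl,
    PowerSeries.coeff_succ_X_mul, coeff_zero_mul', map_add, PowerSeries.coeff_zero_X_mul] at e1
  simp [PowerSeries.coeff_one, PowerSeries.coeff_C] at e0 e1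
  have hv0 : PowerSeries.coeff 0 v = (PowerSeries.coeff 1 F)⁻¹ := by
    simpa using eq_inv_of_mul_eq_one_left e0.symm
  refine ⟨v, fun u => ⟨fun ⟨hu, hF⟩ => ?_, ?_⟩, hv0, ?_⟩
  · have hsub : PowerSeries.HasSubst u := PowerSeries.HasSubst.of_constantCoeff_zero' hu
    have hsF : PowerSeries.HasSubst F := PowerSeries.HasSubst.of_constantCoeff_zero' h0
    -- Uniqueness: `u₀(F(u))` equals `u` because `u₀(F) = X`, and equals `u₀` because `F(u) = X`.
    have h2 := PowerSeries.subst_comp_subst_apply hsF hsub u₀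
    rw [hl, hF, PowerSeries.subst_X hsub, PowerSeries.X_subst] at h2
    rw [h2, hv]
  · rintro rfl
    rw [← hv]
    exact ⟨hc, hr⟩
  · simp only [PowerSeries.coeff_zero_eq_constantCoeff] at hv0
    rw [hv0] at e1
    field_simp at e1 ⊢
    linear_combination -e1

theorem momentSeries_constantCoeff (μ : Measure ℝ) :
    PowerSeries.constantCoeff (momentSeries μ) = 0 := by
  rw [← PowerSeries.coeff_zero_eq_constantCoeff_apply]; simp [momentSeries]

theorem momentSeries_coeff (μ : Measure ℝ) {n : ℕ} (hn : n ≠ 0) :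
    PowerSeries.coeff n (momentSeries μ) = ((∫ t, t ^ n ∂μ : ℝ) : ℂ) := by
  simp [momentSeries, hn]

/-- `1 / z(w) = w v(w)` and `S(w) = (1 + w) v(w)`, with `v` known to first order. -/
theorem exists_invZ (μ : Measure ℝ) {a₁ a₂ : ℂ} (h₁ : ((∫ t, t ^ 1 ∂μ : ℝ) : ℂ) = a₁)
    (h₂ : ((∫ t, t ^ 2 ∂μ : ℝ) : ℂ) = a₂) (ha : a₁ ≠ 0) :
    ∃ v : ℂ⟦X⟧, (∀ u, IsInvZ μ u ↔ u = PowerSeries.X * v) ∧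
      (∀ S, IsSTransform μ S ↔ S = (1 + PowerSeries.X) * v) ∧
      PowerSeries.coeff 0 v = a₁⁻¹ ∧ PowerSeries.coeff 1 v = -a₂ / a₁ ^ 3 := by
  have c1 := momentSeries_coeff μ one_ne_zero
  have c2 := momentSeries_coeff μ two_ne_zero
  rw [h₁] at c1
  rw [h₂] at c2
  obtain ⟨v, hv, hv0, hv1⟩ := exists_subst_inverse (momentSeries μ)
    (momentSeries_constantCoeff μ) (by rwa [c1])
  rw [c1] at hv0
  rw [c1, c2] at hv1
  refine ⟨v, hv, fun S => ⟨?_, ?_⟩, hv0, hv1⟩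
  · rintro ⟨u, hu, hS⟩
    rw [(hv u).1 hu] at hS
    refine mul_left_cancel₀ (PowerSeries.X_ne_zero (R := ℂ)) ?_
    rw [hS]; ring
  · rintro rfl
    exact ⟨_, (hv _).2 rfl, by ring⟩

/-- The series `z₀ / z_I` for measures with given first two moments. -/
theorem exists_series_quotient (σ σI ν : Measure ℝ) {a₁ a₂ b₁ b₂ c₁ c₂ : ℂ}
    (ha₁ : ((∫ t, t ^ 1 ∂σ : ℝ) : ℂ) = a₁) (ha₂ : ((∫ t, t ^ 2 ∂σ : ℝ) : ℂ) = a₂)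
    (hb₁ : ((∫ t, t ^ 1 ∂σI : ℝ) : ℂ) = b₁) (hb₂ : ((∫ t, t ^ 2 ∂σI : ℝ) : ℂ) = b₂)
    (hc₁ : ((∫ t, t ^ 1 ∂ν : ℝ) : ℂ) = c₁) (hc₂ : ((∫ t, t ^ 2 ∂ν : ℝ) : ℂ) = c₂)
    (ha : a₁ ≠ 0) (hb : b₁ ≠ 0) (hc : c₁ ≠ 0) :
    ∃ u₀ uI S₀ SI Sh q : ℂ⟦X⟧,
      (∀ u, IsInvZ σ u ↔ u = u₀) ∧ (∀ u, IsInvZ σI u ↔ u = uI) ∧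
      (∀ S, IsSTransform σ S ↔ S = S₀) ∧ (∀ S, IsSTransform σI S ↔ S = SI) ∧
      (∀ S, IsSTransform ν S ↔ S = Sh) ∧
      (∀ p, p * u₀ = uI ↔ p = q) ∧
      PowerSeries.coeff 0 q = a₁ / b₁ ∧
      PowerSeries.coeff 1 q = a₁ / b₁ * (a₂ / a₁ ^ 2 - b₂ / b₁ ^ 2) ∧
      (SI = Sh * S₀ ↔ q = Sh) ∧
      (SI = Sh * S₀ → b₁ = c₁ * a₁ ∧ b₂ / b₁ ^ 2 - a₂ / a₁ ^ 2 = c₂ / c₁ ^ 2 - 1) := by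
  obtain ⟨v, hv, hvS, hv0, hv1⟩ := exists_invZ σ ha₁ ha₂ ha
  obtain ⟨x, hx, hxS, hx0, hx1⟩ := exists_invZ σI hb₁ hb₂ hb
  obtain ⟨y, -, hyS, hy0, hy1⟩ := exists_invZ ν hc₁ hc₂ hc
  have hX : (PowerSeries.X : ℂ⟦X⟧) ≠ 0 := PowerSeries.X_ne_zero
  have hvc : PowerSeries.constantCoeff v ≠ 0 := by
    rw [← PowerSeries.coeff_zero_eq_constantCoeff_apply, hv0]; exact inv_ne_zero ha
  have hv_ne : v ≠ 0 := by
    rintro rfl; simp at hvc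
  have h1X : (1 + PowerSeries.X : ℂ⟦X⟧) ≠ 0 := by
    intro h
    have := congrArg PowerSeries.constantCoeff h
    simp at this
  -- After removal of the common factor `X`, the quotient `z₀/z_I` is `x / v`, and `v` is invertible
  -- because its constant term is `1 / a₁`.
  obtain ⟨q, hq⟩ : ∃ q : ℂ⟦X⟧, q * v = x := ⟨x * v⁻¹, by
    rw [mul_assoc, PowerSeries.inv_mul_cancel v hvc, mul_one]⟩
  have e0 := congrArg (PowerSeries.coeff 0) hq
  have e1 := congrArg (PowerSeries.coeff 1) hq
  rw [coeff_zero_mul', hv0, hx0] at e0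
  rw [coeff_one_mul', hv0, hv1, hx1] at e1
  have hq0 : PowerSeries.coeff 0 q = a₁ / b₁ := by
    field_simp at e0 ⊢; linear_combination e0
  have hq1 : PowerSeries.coeff 1 q = a₁ / b₁ * (a₂ / a₁ ^ 2 - b₂ / b₁ ^ 2) := by
    rw [hq0] at e1
    field_simp at e1 ⊢
    linear_combination e1
  -- With `x = q v`, both sides of `S_I = S_h S_0` carry the nonzero factor `(1 + X) v`, which
  -- cancels.
  have hiff : (1 + PowerSeries.X) * x = (1 + PowerSeries.X) * y * ((1 + PowerSeries.X) * v) ↔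
      q = (1 + PowerSeries.X) * y := by
    rw [← hq]
    constructor
    · intro h
      refine mul_right_cancel₀ (mul_ne_zero h1X hv_ne) ?_
      rw [← h]; ring
    · rintro rfl; ring
  refine ⟨PowerSeries.X * v, PowerSeries.X * x, (1 + PowerSeries.X) * v,
    (1 + PowerSeries.X) * x, (1 + PowerSeries.X) * y, q, hv, hx, hvS, hxS, hyS, fun p => ?_,
    hq0, hq1, hiff, fun h => ?_⟩
  · rw [← hq]
    constructor
    · intro h
      refine mul_right_cancel₀ (mul_ne_zero hX hv_ne) ?_
      rw [h]; ring
    · rintro rfl; ring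
  · have h := hiff.1 h
    have f0 := congrArg (PowerSeries.coeff 0) h
    have f1 := congrArg (PowerSeries.coeff 1) h
    rw [add_mul, one_mul, map_add, hy0, hq0] at f0
    -- The linear coefficient of `S_h` is `1/c₁ - c₂/c₁³`; its first term, due to the factor `1 +
    -- w`, is the source of the `-1` in the conclusion.
    rw [add_mul, one_mul, map_add, hy1, hq1,
      show (1 : ℕ) = 0 + 1 from rfl, PowerSeries.coeff_succ_X_mul, hy0] at f1
    simp only [PowerSeries.coeff_zero_X_mul, add_zero] at f0
    have hb' : b₁ = c₁ * a₁ := by field_simp at f0; linear_combination -f0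
    refine ⟨hb', ?_⟩
    rw [f0] at f1
    field_simp at f1 ⊢
    linear_combination -f1

/-! ### Consequences of freeness -/

/-- The letters of a word which belong to the second algebra. -/
def secondLetters {B : Type*} (L : List (Bool × B)) : List B :=
  (L.filter fun x => !x.1).map Prod.snd

theorem secondLetters_append {B : Type*} (K L : List (Bool × B)) :
    secondLetters (K ++ L) = secondLetters K ++ secondLetters L := by
  simp [secondLetters]

theorem secondLetters_cons_true {B : Type*} (x : B) (L : List (Bool × B)) :
    secondLetters ((true, x) :: L) = secondLetters L := by
  simp [secondLetters]

theorem secondLetters_cons_false {B : Type*} (x : B) (L : List (Bool × B)) :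
    secondLetters ((false, x) :: L) = x :: secondLetters L := by
  simp [secondLetters]

section Freeness

variable {A : Type*} [Ring A] [Algebra ℂ A]

/-- Freeness for lists of coloured letters: the arguments below cut words, delete letters and merge
neighbours, which is easier on lists than on families indexed by `Fin (n + 1)`. -/
theorem AreFree.list_prod {φ : A →ₗ[ℂ] ℂ} {A₁ A₂ : Subalgebra ℂ A} (h : AreFree φ A₁ A₂)
    (L : List (Bool × A)) (hne : L ≠ []) (hch : L.IsChain (fun x y => x.1 ≠ y.1))
    (hmem : ∀ x ∈ L, x.2 ∈ (if x.1 then A₁ else A₂)) (h0 : ∀ x ∈ L, φ x.2 = 0) :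
    φ (L.map Prod.snd).prod = 0 := by
  obtain ⟨n, hn⟩ : ∃ n, L.length = n + 1 :=
    Nat.exists_eq_succ_of_ne_zero (by simpa using hne)
  have key := h n (fun k => (L.get (Fin.cast hn.symm k)).1)
    (fun k => (L.get (Fin.cast hn.symm k)).2) (fun k => ?_)
    (fun k => hmem _ (List.get_mem _ _)) (fun k => h0 _ (List.get_mem _ _))
  · convert key using 3
    refine List.ext_get (by simp [hn]) fun i h₁ h₂ => by simp [-List.ofFn_succ]
  · have := List.isChain_iff_getElem.1 hch k (by have := k.2; omega)
    simpa using this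

theorem AreFree.symm {φ : A →ₗ[ℂ] ℂ} {A₁ A₂ : Subalgebra ℂ A} (h : AreFree φ A₁ A₂) :
    AreFree φ A₂ A₁ := by
  intro n c x hc hx h0
  refine h n (fun k => !c k) x (fun k => by simpa using hc k) (fun k => ?_) h0
  have := hx k
  cases hk : c k <;> simp_all

/-- Either a list of letters is alternating, or two neighbours have the same colour. -/
theorem isChain_or_exists_adjacent {B : Type*} (L : List (Bool × B)) :
    L.IsChain (fun x y => x.1 ≠ y.1) ∨
      ∃ (L₁ L₂ : List (Bool × B)) (c : Bool) (x y : B), L = L₁ ++ (c, x) :: (c, y) :: L₂ := by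
  induction L with
  | nil => exact Or.inl .nil
  | cons a L ih =>
    rcases ih with ih | ⟨L₁, L₂, c, x, y, rfl⟩
    · cases L with
      | nil => exact Or.inl (.singleton _)
      | cons b L =>
        by_cases hab : a.1 = b.1
        · exact Or.inr ⟨[], L, b.1, a.2, b.2, by simp [Prod.ext_iff, hab]⟩
        · exact Or.inl (.cons_cons hab ih)
    · exact Or.inr ⟨a :: L₁, L₂, c, x, y, rfl⟩

/-- An element is centered by subtracting its expectation. -/
def center (φ : A →ₗ[ℂ] ℂ) (x : A) : A := x - algebraMap ℂ A (φ x)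

theorem map_center {φ : A →ₗ[ℂ] ℂ} (h1 : φ 1 = 1) (x : A) : φ (center φ x) = 0 := by
  simp [center, Algebra.algebraMap_eq_smul_one, h1]

theorem center_mem {φ : A →ₗ[ℂ] ℂ} {B : Subalgebra ℂ A} {x : A} (hx : x ∈ B) :
    center φ x ∈ B :=
  B.sub_mem hx (B.algebraMap_mem _)

theorem map_mul_center_mul (φ : A →ₗ[ℂ] ℂ) (u x v : A) :
    φ (u * center φ x * v) = φ (u * x * v) - φ x * φ (u * v) := by
  simp [center, mul_sub, sub_mul, Algebra.algebraMap_eq_smul_one]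

/-- If `d` is orthogonal to all products of sublists of the letters of the second algebra in a
word, then it is orthogonal to the word. -/
theorem AreFree.orthogonal_word {φ : A →ₗ[ℂ] ℂ} {A₁ A₂ : Subalgebra ℂ A} (h : AreFree φ A₁ A₂)
    (h1 : φ 1 = 1) (m : ℕ) : ∀ (K L : List (Bool × A)) (d : A), K.length + L.length = m →
      d ∈ A₂ → (∀ x ∈ K ++ L, x.2 ∈ (if x.1 then A₁ else A₂)) → (∀ x ∈ K, φ x.2 = 0) →
      (∀ s : List A, s.Sublist (secondLetters (K ++ L)) → φ (d * s.prod) = 0) →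
      φ (d * ((K ++ L).map Prod.snd).prod) = 0 := by
  -- The letters of `K` are already centered, those of `L` are not. An outer induction on the length
  -- of the word contains an inner one that moves the letters of `L` to `K` one by one.
  induction m using Nat.strong_induction_on with
  | _ m IH =>
  intro K L
  induction L generalizing K with
  | nil =>
    intro d hlen hd hmem hK hs
    simp only [List.append_nil] at *
    -- All letters are centered. If they alternate, either `d` is the first letter of an alternating
    -- centered word, or the word starts in `A₂` and its first letter is absorbed into `d`.
    rcases isChain_or_exists_adjacent K with hch | ⟨L₁, L₂, c, x, y, rfl⟩
    · match K, hlen, hmem, hK, hs, hch with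
      | [], _, _, _, hs, _ => simpa using hs [] (by simp)
      | (true, x) :: K, _, hmem, hK, hs, hch =>
        have := h.list_prod ((false, d) :: (true, x) :: K) (by simp)
          (.cons_cons (by simp) hch)
          (by
            intro z hz
            rcases List.mem_cons.1 hz with rfl | hz
            · simpa using hd
            · exact hmem z hz)
          (by
            intro z hz
            rcases List.mem_cons.1 hz with rfl | hz
            · simpa using hs [] (by simp)
            · exact hK z hz)
        simpa using this
      | (false, x) :: K, hlen, hmem, hK, hs, hch =>
        have hx : x ∈ A₂ := by simpa using hmem (false, x) (by simp)
        have := IH K.length (by simp at hlen; omega) [] K (d * x) (by simp)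
          (A₂.mul_mem hd hx) (fun z hz => hmem z (by simp at hz ⊢; tauto)) (by simp)
          (fun s hsub => by
            have := hs (x :: s) (by
              rw [secondLetters_cons_false]; simpa using hsub)
            simpa [mul_assoc] using this)
        simpa [mul_assoc] using this
    -- Two neighbours from the same algebra are multiplied. The product need not be centered, so the
    -- shorter word is treated with no letter marked as centered.
    · have hx := hmem (c, x) (by simp)
      have hy := hmem (c, y) (by simp)
      have := IH (L₁.length + (L₂.length + 1)) (by simp at hlen; omega) [] (L₁ ++ (c, x * y) :: L₂) d
        (by simp) hd
        (by
          intro z hz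
          simp only [List.nil_append, List.mem_append, List.mem_cons] at hz
          rcases hz with hz | rfl | hz
          · exact hmem z (by simp [hz])
          · exact Subalgebra.mul_mem _ hx hy
          · exact hmem z (by simp [hz]))
        (by simp)
        (by
          intro s hsub
          rw [List.nil_append, secondLetters_append] at hsub
          rw [secondLetters_append] at hs
          cases c with
          | true =>
            rw [secondLetters_cons_true] at hsub
            rw [secondLetters_cons_true, secondLetters_cons_true] at hs
            exact hs s hsub
          | false =>
            rw [secondLetters_cons_false] at hsub
            rw [secondLetters_cons_false, secondLetters_cons_false] at hs
            obtain ⟨s₁, s₂, rfl, hs₁, hs₂⟩ := List.sublist_append_iff.1 hsub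
            cases hs₂ with
            | cons _ hs₂ => exact hs _ (hs₁.append ((hs₂.cons _).cons _))
            | @cons_cons s₂ _ _ hs₂ =>
              have := hs (s₁ ++ x :: y :: s₂) (hs₁.append ((hs₂.cons_cons _).cons_cons _))
              simpa [mul_assoc] using this)
      simpa [mul_assoc] using this
  | cons x L ihL =>
    intro d hlen hd hmem hK hs
    -- A letter is its centered version plus a scalar: the first term has one more centered letter,
    -- the second is a shorter word.
    have e1 := ihL (K ++ [(x.1, center φ x.2)]) d (by simp at hlen ⊢; omega) hd
      (by
        intro z hz
        simp only [List.append_assoc, List.singleton_append, List.mem_append,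
          List.mem_cons] at hz
        rcases hz with hz | rfl | hz
        · exact hmem z (by simp [hz])
        · exact center_mem (hmem x (by simp))
        · exact hmem z (by simp [hz]))
      (by
        intro z hz
        simp only [List.mem_append, List.mem_singleton] at hz
        rcases hz with hz | rfl
        · exact hK z hz
        · exact map_center h1 _)
      (by
        intro s hsub
        obtain ⟨c, x⟩ := x
        rw [List.append_assoc, List.singleton_append, secondLetters_append] at hsub
        rw [secondLetters_append] at hs
        cases c with
        | true =>
          rw [secondLetters_cons_true] at hs hsub
          exact hs s hsub
        | false =>
          rw [secondLetters_cons_false] at hs hsub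
          obtain ⟨s₁, s₂, rfl, hs₁, hs₂⟩ := List.sublist_append_iff.1 hsub
          cases hs₂ with
          | cons _ hs₂ => exact hs _ (hs₁.append (hs₂.cons _))
          | @cons_cons s₂ _ _ hs₂ =>
            have e1 := hs (s₁ ++ x :: s₂) (hs₁.append (hs₂.cons_cons _))
            have e2 := hs (s₁ ++ s₂) (hs₁.append (hs₂.cons _))
            have := map_mul_center_mul φ (d * s₁.prod) x s₂.prod
            simp only [List.prod_append, List.prod_cons, mul_assoc] at e1 e2 this ⊢
            rw [this, e1, e2]; simp)
    have e2 := IH (K.length + L.length) (by simp at hlen; omega) K L d rfl hd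
      (by
        intro z hz
        simp only [List.mem_append] at hz
        exact hmem z (by simp; tauto))
      hK
      (fun s hsub => hs s (hsub.trans (by
        rw [secondLetters_append, secondLetters_append]
        exact (List.Sublist.refl _).append
          (((List.sublist_cons_self x L).filter _).map _))))
    have := map_mul_center_mul φ (d * (K.map Prod.snd).prod) x.2 (L.map Prod.snd).prod
    simp only [List.map_append, List.prod_append, List.map_cons, List.prod_cons, List.map_nil,
      List.prod_nil, mul_one, mul_assoc] at e1 e2 this ⊢
    rw [e1, e2] at this
    linear_combination -this

/-! ### Moments of free compressions as polynomials in the trace of the projection -/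

/-- The letter `(true, k)` stands for `a ^ (k + 1)`, the letter `(false, k)` for
`b ^ (k + 1)`. -/
def powLetter (b a : A) (x : Bool × ℕ) : A := if x.1 then a ^ (x.2 + 1) else b ^ (x.2 + 1)

/-- The elements `b`, `a` are free, `a` has moments `α`, and all the moments of `b` are equal to
`ℓ`, as for a projection. -/
structure IsFreeProjPair (α : ℕ → ℂ) (φ : A →ₗ[ℂ] ℂ) (b a : A) (ℓ : ℂ) : Prop where
  map_one : φ 1 = 1
  free : AreFree φ (Algebra.adjoin ℂ {a}) (Algebra.adjoin ℂ {b})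
  map_pow_left : ∀ k, φ (b ^ (k + 1)) = ℓ
  map_pow_right : ∀ k, φ (a ^ k) = α k

end Freeness

/-- The moment of a word, some letters of which are centered, is a polynomial in `ℓ`. -/
def IsPolyMoment (α : ℕ → ℂ) (K L : List (Bool × ℕ)) : Prop :=
  ∃ f : Polynomial ℂ, f.natDegree ≤ (K ++ L).countP (fun x => !x.1) ∧
    ∀ (A : Type) [Ring A] [Algebra ℂ A] (φ : A →ₗ[ℂ] ℂ) (b a : A) (ℓ : ℂ),
      IsFreeProjPair α φ b a ℓ →
      φ ((K.map fun x => center φ (powLetter b a x)).prod * (L.map (powLetter b a)).prod) =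
        f.eval ℓ

/-- Centering `x` subtracts `φ(x)` times the moment of the word without `x`. For a power of `b` this
scalar is `ℓ`, so the degree rises by one together with the number of such letters; for a power of
`a` it is a constant taken from `α`. -/
theorem isPolyMoment_center_iff (α : ℕ → ℂ) (K L : List (Bool × ℕ)) (x : Bool × ℕ)
    (h : IsPolyMoment α K L) :
    IsPolyMoment α (K ++ [x]) L ↔ IsPolyMoment α K (x :: L) := by
  obtain ⟨f, hf, hfe⟩ := h
  set μ : Polynomial ℂ := if x.1 then Polynomial.C (α (x.2 + 1)) else Polynomial.X with hμ
  have hdeg : (μ * f).natDegree ≤ (K ++ x :: L).countP (fun x => !x.1) := by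
    refine Polynomial.natDegree_mul_le.trans ?_
    rw [List.countP_append, List.countP_cons]
    rw [List.countP_append] at hf
    rcases x with ⟨_ | _, k⟩ <;> simp [hμ] at hf ⊢ <;> omega
  have hval : ∀ (A : Type) [Ring A] [Algebra ℂ A] (φ : A →ₗ[ℂ] ℂ) (b a : A) (ℓ : ℂ),
      IsFreeProjPair α φ b a ℓ → φ (powLetter b a x) = μ.eval ℓ := by
    intro A _ _ φ b a ℓ hM
    rcases x with ⟨_ | _, k⟩
    · simp [powLetter, hμ, hM.map_pow_left]
    · simp [powLetter, hμ, hM.map_pow_right]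
  have hsplit : ∀ (A : Type) [Ring A] [Algebra ℂ A] (φ : A →ₗ[ℂ] ℂ) (b a : A) (ℓ : ℂ),
      IsFreeProjPair α φ b a ℓ →
      φ (((K ++ [x]).map fun x => center φ (powLetter b a x)).prod *
        (L.map (powLetter b a)).prod) =
      φ ((K.map fun x => center φ (powLetter b a x)).prod *
        ((x :: L).map (powLetter b a)).prod) - (μ * f).eval ℓ := by
    intro A _ _ φ b a ℓ hM
    rw [Polynomial.eval_mul, ← hfe A φ b a ℓ hM, ← hval A φ b a ℓ hM, List.map_append,
      List.prod_append, List.map_singleton, List.prod_singleton, map_mul_center_mul,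
      List.map_cons, List.prod_cons, mul_assoc]
  have hcount : (K ++ [x] ++ L).countP (fun x => !x.1) =
      (K ++ x :: L).countP (fun x => !x.1) := by simp
  constructor
  · rintro ⟨p, hp, hpe⟩
    refine ⟨p + μ * f, Polynomial.natDegree_add_le_of_degree_le (hcount ▸ hp) hdeg,
      fun A _ _ φ b a ℓ hM => ?_⟩
    rw [Polynomial.eval_add, ← hpe A φ b a ℓ hM, hsplit A φ b a ℓ hM]; ring
  · rintro ⟨p, hp, hpe⟩
    refine ⟨p - μ * f, (Polynomial.natDegree_sub_le_of_le hp hdeg).trans (by simp),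
      fun A _ _ φ b a ℓ hM => ?_⟩
    rw [Polynomial.eval_sub, ← hpe A φ b a ℓ hM, hsplit A φ b a ℓ hM]

/-- Modulo shorter words all letters may be centered. An alternating word then has moment zero by
freeness, and any other word is shortened by merging two neighbours. -/
theorem isPolyMoment (α : ℕ → ℂ) (m : ℕ) :
    ∀ K L : List (Bool × ℕ), K.length + L.length = m → IsPolyMoment α K L := by
  induction m using Nat.strong_induction_on with
  | _ m IH =>
  have hiff : ∀ L K : List (Bool × ℕ), K.length + L.length = m →
      (IsPolyMoment α (K ++ L) [] ↔ IsPolyMoment α K L) := by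
    intro L
    induction L with
    | nil => simp
    | cons x L ih =>
      intro K hK
      rw [← isPolyMoment_center_iff α K L x (IH _ (by simp at hK; omega) K L rfl),
        ← ih (K ++ [x]) (by simp at hK ⊢; omega)]
      simp
  have hall : ∀ L : List (Bool × ℕ), L.length = m → IsPolyMoment α L [] := by
    intro L hL
    by_cases hne : L = []
    · subst hne
      exact ⟨1, by simp, fun A _ _ φ b a ℓ hM => by simp [hM.map_one]⟩
    rcases isChain_or_exists_adjacent L with hch | ⟨L₁, L₂, c, x, y, rfl⟩
    · refine ⟨0, by simp, fun A _ _ φ b a ℓ hM => ?_⟩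
      have := hM.free.list_prod (L.map fun x => (x.1, center φ (powLetter b a x)))
        (by simpa using hne) (by rw [List.isChain_map]; exact hch)
        (by
          intro z hz
          obtain ⟨⟨c, k⟩, -, rfl⟩ := List.mem_map.1 hz
          cases c
          · exact center_mem (Subalgebra.pow_mem _ (Algebra.subset_adjoin (by simp)) _)
          · exact center_mem (Subalgebra.pow_mem _ (Algebra.subset_adjoin (by simp)) _))
        (by
          intro z hz
          obtain ⟨x, -, rfl⟩ := List.mem_map.1 hz
          exact map_center hM.map_one _)
      simpa [Function.comp_def] using this
    -- Merging requires uncentered letters, hence the return to the uncentered word. The merged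
    -- label is `x + y + 1` because the label `k` stands for the exponent `k + 1`.
    · have h2 := (hiff (L₁ ++ (c, x) :: (c, y) :: L₂) [] (by simpa using hL))
      rw [List.nil_append] at h2
      rw [h2]
      obtain ⟨f, hf, hfe⟩ := IH (L₁.length + (L₂.length + 1)) (by simp at hL; omega) []
        (L₁ ++ (c, x + y + 1) :: L₂) (by simp)
      refine ⟨f, hf.trans ?_, fun A _ _ φ b a ℓ hM => ?_⟩
      · simp [List.countP_cons]
      · rw [← hfe A φ b a ℓ hM]
        congr 1
        simp only [List.map_nil, List.prod_nil, one_mul, List.map_append, List.prod_append,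
          List.map_cons, List.prod_cons]
        congr 1
        rw [← mul_assoc]
        congr 1
        cases c <;> simp only [powLetter, Bool.false_eq_true, if_true, if_false, ← pow_add] <;>
          congr 1 <;> ring
  intro K L hKL
  exact (hiff L K hKL).1 (hall _ (by simpa using hKL))

/-- The `n`-th moment of the free compression of `a` by a projection of trace `ℓ` is a polynomial
in `ℓ`, of degree at most `n`. -/
theorem exists_poly_moment (α : ℕ → ℂ) (n : ℕ) :
    ∃ f : Polynomial ℂ, f.natDegree ≤ n ∧
      ∀ (A : Type) [Ring A] [Algebra ℂ A] (φ : A →ₗ[ℂ] ℂ) (b a : A) (ℓ : ℂ),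
        IsFreeProjPair α φ b a ℓ → φ ((b * a) ^ n) = f.eval ℓ := by
  obtain ⟨f, hf, hfe⟩ := isPolyMoment α _ []
    (List.replicate n [(false, 0), (true, 0)]).flatten rfl
  refine ⟨f, hf.trans ?_, fun A _ _ φ b a ℓ hM => ?_⟩
  · simp [List.countP_flatten]
  · rw [← hfe A φ b a ℓ hM]
    congr 1
    simp [List.map_flatten, powLetter, List.prod_flatten]

/-! ### Inclusion-exclusion -/

/-- The condition says that `U` is contained in the complement of the range of `f`, and the
alternating sum over the subsets of a set vanishes unless the set is empty. -/
theorem sum_neg_one_pow_compl_of_forall_mem {n j : ℕ} {R : Type*} [CommRing R]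
    (f : Fin j → Fin n) :
    ∑ U : Finset (Fin n), (if ∀ k, f k ∈ Uᶜ then (-1 : R) ^ U.card else 0) =
      if Function.Surjective f then 1 else 0 := by
  classical
  set T : Finset (Fin n) := (Finset.univ.image f)ᶜ with hT
  have h1 : ∀ U : Finset (Fin n), (∀ k, f k ∈ Uᶜ) ↔ U ∈ T.powerset := by
    intro U
    simp only [Finset.mem_powerset, hT, Finset.subset_iff, Finset.mem_compl, Finset.mem_image,
      Finset.mem_univ, true_and, not_exists]
    exact ⟨fun h u hu k hk => h k (hk ▸ hu), fun h k hk => h hk k rfl⟩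
  have h2 := Finset.sum_powerset_neg_one_pow_card (x := T)
  have h3 := congrArg (Int.cast : ℤ → R) h2
  push_cast at h3
  simp only [h1]
  rw [← Finset.sum_filter, Finset.filter_mem_eq_inter, Finset.univ_inter, h3]
  have h4 : T = ∅ ↔ Function.Surjective f := by
    rw [hT, Finset.compl_eq_empty_iff]
    simp [Finset.eq_univ_iff_forall, Function.Surjective]
  simp [h4]

/-- Polarization: after expansion of the product, only the maps reaching every index survive. There
are none for `j < n`, and for `j = n` they are the permutations. -/
theorem sum_neg_one_pow_prod_sum_compl {n j : ℕ} {R : Type*} [CommRing R]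
    (m : Fin j → Fin n → R) :
    ∑ U : Finset (Fin n), (-1 : R) ^ U.card * ∏ k, ∑ c ∈ Uᶜ, m k c =
      ∑ f : Fin j → Fin n, if Function.Surjective f then ∏ k, m k (f k) else 0 := by
  classical
  have h1 : ∀ U : Finset (Fin n), (-1 : R) ^ U.card * ∏ k, ∑ c ∈ Uᶜ, m k c =
      ∑ f : Fin j → Fin n, (if ∀ k, f k ∈ Uᶜ then (-1 : R) ^ U.card else 0) *
        ∏ k, m k (f k) := by
    intro U
    rw [Finset.prod_univ_sum, Finset.mul_sum]
    simp only [ite_mul, zero_mul]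
    rw [← Finset.sum_filter]
    refine Finset.sum_congr ?_ fun _ _ => rfl
    ext f; simp
  simp only [h1]
  rw [Finset.sum_comm]
  refine Finset.sum_congr rfl fun f _ => ?_
  rw [← Finset.sum_mul, sum_neg_one_pow_compl_of_forall_mem]
  simp

theorem sum_surjective_eq_sum_perm {n : ℕ} {R : Type*} [AddCommMonoid R]
    (F : (Fin n → Fin n) → R) :
    (∑ f : Fin n → Fin n, if Function.Surjective f then F f else 0) =
      ∑ τ : Equiv.Perm (Fin n), F τ := by
  classical
  rw [← Finset.sum_filter]
  symm
  refine Finset.sum_bij (fun τ _ => ⇑τ) (fun τ _ => by simp [τ.surjective])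
    (fun _ _ _ _ h => DFunLike.coe_injective h) (fun f hf => ?_) (fun _ _ => rfl)
  have hf' : Function.Surjective f := by simpa using hf
  exact ⟨Equiv.ofBijective f ⟨Finite.injective_iff_surjective.2 hf', hf'⟩, Finset.mem_univ _, rfl⟩

/-- The polarization of a polynomial of degree at most `n` only sees its top coefficient. -/
theorem sum_neg_one_pow_eval {n : ℕ} (f : Polynomial ℂ) (hf : f.natDegree ≤ n) (ℓ : ℂ) :
    ∑ U : Finset (Fin n), (-1 : ℂ) ^ U.card * f.eval (∑ _c ∈ Uᶜ, ℓ) =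
      n.factorial * (ℓ ^ n * f.coeff n) := by
  have h1 : ∀ j ∈ Finset.range (n + 1),
      ∑ U : Finset (Fin n), (-1 : ℂ) ^ U.card * (∑ _c ∈ Uᶜ, ℓ) ^ j =
        if j = n then n.factorial * ℓ ^ n else 0 := by
    intro j hj
    have h := sum_neg_one_pow_prod_sum_compl (n := n) (j := j) (fun _ _ => ℓ)
    simp only [Finset.prod_const, Finset.card_univ, Fintype.card_fin] at h
    rw [h]
    split_ifs with hjn
    · subst hjn
      rw [sum_surjective_eq_sum_perm fun _ => ℓ ^ j]
      simp [Fintype.card_perm]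
    · refine Finset.sum_eq_zero fun f _ => ?_
      rw [if_neg]
      intro hs
      have := Fintype.card_le_of_surjective f hs
      simp only [Fintype.card_fin] at this
      simp at hj
      omega
  simp only [Polynomial.eval_eq_sum_range' (Nat.lt_succ_of_le hf), Finset.mul_sum]
  rw [Finset.sum_comm]
  calc _ = ∑ j ∈ Finset.range (n + 1), f.coeff j *
        ∑ U : Finset (Fin n), (-1 : ℂ) ^ U.card * (∑ _c ∈ Uᶜ, ℓ) ^ j := by
        refine Finset.sum_congr rfl fun j _ => ?_
        rw [Finset.mul_sum]
        exact Finset.sum_congr rfl fun U _ => by ring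
    _ = _ := by
        rw [Finset.sum_congr rfl fun j hj => by rw [h1 j hj]]
        simp; ring

/-! ### Points of the cube with distinct coordinates -/

/-- Points in the interior of the cube, with distinct coordinates. -/
def genericCube (n : ℕ) : Set (Fin n → ℝ) :=
  {x | Function.Injective x ∧ ∀ k, 0 < x k ∧ x k < 1}

theorem genericCube_subset (n : ℕ) : genericCube n ⊆ Set.Icc 0 1 := fun _ hx =>
  ⟨fun k => (hx.2 k).1.le, fun k => (hx.2 k).2.le⟩

/-- Move `x` along the segment towards the interior point with coordinates `(k + 1) / (n + 1)`.
Coordinates that agree at `x` separate at once, and those that differ stay different for small `t`.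
-/
theorem exists_tendsto_genericCube {n : ℕ} {x : Fin n → ℝ} (hx : x ∈ Set.Icc (0 : Fin n → ℝ) 1) :
    ∃ y : ℝ → Fin n → ℝ, (∀ᶠ t in 𝓝[>] 0, y t ∈ genericCube n) ∧
      Tendsto y (𝓝[>] 0) (𝓝[Set.Icc 0 1] x) := by
  set z : Fin n → ℝ := fun k => ((k : ℝ) + 1) / (n + 1) with hz
  have hn : (0 : ℝ) < n + 1 := by positivity
  have hz0 : ∀ k, 0 < z k := fun k => by simp only [hz]; positivity
  have hz1 : ∀ k, z k < 1 := fun k => by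
    simp only [hz]
    rw [div_lt_one hn]
    have : (k : ℝ) < n := by exact_mod_cast k.2
    linarith
  have hzi : Function.Injective z := fun k j h => by
    simp only [hz] at h
    rw [div_left_inj' hn.ne'] at h
    exact Fin.ext (by exact_mod_cast add_right_cancel h)
  have hgen : ∀ᶠ t in 𝓝[>] (0 : ℝ), (fun k => (1 - t) * x k + t * z k) ∈ genericCube n := by
    have hpos : ∀ᶠ t in 𝓝[>] (0 : ℝ), 0 < t := eventually_mem_nhdsWithin
    have hone : ∀ᶠ t in 𝓝[>] (0 : ℝ), t < 1 :=
      (eventually_lt_nhds zero_lt_one).filter_mono nhdsWithin_le_nhds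
    have hpair : ∀ᶠ t in 𝓝[>] (0 : ℝ), ∀ p : Fin n × Fin n, p.1 ≠ p.2 →
        (1 - t) * x p.1 + t * z p.1 ≠ (1 - t) * x p.2 + t * z p.2 := by
      rw [eventually_all]
      rintro ⟨k, j⟩
      by_cases hkj : k = j
      · simp [hkj]
      by_cases hxe : x k = x j
      · filter_upwards [hpos] with t ht _ h
        simp only [hxe, add_right_inj, mul_eq_mul_left_iff, ht.ne', or_false] at h
        exact hkj (hzi h)
      · have hc : Tendsto (fun t : ℝ => ((1 - t) * x k + t * z k) - ((1 - t) * x j + t * z j))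
            (𝓝[>] 0) (𝓝 (x k - x j)) := by
          have : Continuous fun t : ℝ =>
            ((1 - t) * x k + t * z k) - ((1 - t) * x j + t * z j) := by fun_prop
          have := (this.tendsto 0).mono_left (nhdsWithin_le_nhds (s := Set.Ioi 0))
          simpa using this
        filter_upwards [hc.eventually_ne (sub_ne_zero.2 hxe)] with t ht _
        exact sub_ne_zero.1 ht
    filter_upwards [hpos, hone, hpair] with t h0 h1 h2
    refine ⟨fun k j h => by_contra fun hkj => h2 (k, j) hkj h, fun k => ⟨?_, ?_⟩⟩
    · have := mul_nonneg (sub_nonneg.2 h1.le) (hx.1 k)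
      have := mul_pos h0 (hz0 k)
      dsimp only [Pi.zero_apply] at *
      linarith
    · have := mul_le_mul_of_nonneg_left (hx.2 k) (sub_nonneg.2 h1.le)
      have := mul_lt_mul_of_pos_left (hz1 k) h0
      simp only [Pi.one_apply] at *
      linarith
  refine ⟨fun t k => (1 - t) * x k + t * z k, hgen, ?_⟩
  refine tendsto_nhdsWithin_iff.2 ⟨?_, hgen.mono fun t ht => genericCube_subset n ht⟩
  have : Continuous fun (t : ℝ) (k : Fin n) => (1 - t) * x k + t * z k := by fun_prop
  have := (this.tendsto 0).mono_left (nhdsWithin_le_nhds (s := Set.Ioi 0))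
  simpa using this

/-- A continuous function on the cube which vanishes at the generic points is zero. -/
theorem eq_zero_of_genericCube {n : ℕ} {f : (Fin n → ℝ) → ℂ}
    (hf : ContinuousOn f (Set.Icc 0 1)) (h : ∀ x ∈ genericCube n, f x = 0)
    {x : Fin n → ℝ} (hx : x ∈ Set.Icc (0 : Fin n → ℝ) 1) : f x = 0 := by
  obtain ⟨y, hy, hyx⟩ := exists_tendsto_genericCube hx
  have h1 : Tendsto (fun t => f (y t)) (𝓝[>] 0) (𝓝 (f x)) := (hf x hx).tendsto.comp hyx
  have h2 : Tendsto (fun t => f (y t)) (𝓝[>] 0) (𝓝 0) :=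
    tendsto_const_nhds.congr' (hy.mono fun t ht => (h _ ht).symm)
  exact tendsto_nhds_unique h1 h2

/-! ### Riemann sums -/

/-- The point of the lattice `ℤ / N` following `x`. -/
def discretize (N : ℕ) (x : ℝ) : ℝ := (⌈(N : ℝ) * x⌉₊ : ℝ) / N

/-- The function factors through `ℕ`, so `f` may be arbitrary. -/
theorem measurable_comp_discretize {E : Type*} [MeasurableSpace E] (N : ℕ) (f : ℝ → E) :
    Measurable fun x => f (discretize N x) := by
  have h1 : Measurable fun x : ℝ => ⌈(N : ℝ) * x⌉₊ :=
    Nat.measurable_ceil.comp (measurable_const.mul measurable_id)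
  exact (measurable_from_nat (f := fun k : ℕ => f ((k : ℝ) / N))).comp h1

theorem discretize_mem {N : ℕ} {x : ℝ} (hx : x ∈ Set.Icc (0 : ℝ) 1) :
    discretize N x ∈ Set.Icc (0 : ℝ) 1 := by
  refine ⟨by unfold discretize; positivity, ?_⟩
  rcases Nat.eq_zero_or_pos N with rfl | hN
  · simp [discretize]
  · have hN' : (0 : ℝ) < N := by exact_mod_cast hN
    rw [discretize, div_le_one hN']
    have : ⌈(N : ℝ) * x⌉₊ ≤ N := Nat.ceil_le.2 (by nlinarith [hx.2])
    exact_mod_cast this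

theorem tendsto_discretize {x : ℝ} (hx : x ∈ Set.Icc (0 : ℝ) 1) :
    Tendsto (fun N => discretize N x) atTop (𝓝[Set.Icc 0 1] x) := by
  refine tendsto_nhdsWithin_iff.2 ⟨?_, Eventually.of_forall fun N => discretize_mem hx⟩
  have h := tendsto_nat_ceil_mul_div_atTop (R := ℝ) hx.1
  have h2 := h.comp tendsto_natCast_atTop_atTop (α := ℕ)
  refine h2.congr fun N => ?_
  simp [discretize, mul_comm]

theorem discretize_eq {N : ℕ} (hN : 0 < N) {k : ℕ} {x : ℝ}
    (hx : x ∈ Set.Ioc ((k : ℝ) / N) ((k + 1 : ℕ) / N)) :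
    discretize N x = ((k : ℝ) + 1) / N := by
  have hN' : (0 : ℝ) < N := by exact_mod_cast hN
  have h1 := (div_lt_iff₀ hN').1 hx.1
  have h2 := (le_div_iff₀ hN').1 hx.2
  have : ⌈(N : ℝ) * x⌉₊ = k + 1 := by
    rw [Nat.ceil_eq_iff (by omega)]
    exact ⟨by simpa [mul_comm] using h1, by rw [mul_comm]; exact h2⟩
  rw [discretize, this]; push_cast; rfl

/-- Riemann sums become integrals of step functions, whose convergence is a matter of dominated
convergence. The ceiling in `discretize` makes the value on each interval the one at its right
endpoint, in agreement with `site`. -/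
theorem integral_discretize {N : ℕ} (hN : 0 < N) (f : ℝ → ℂ) :
    ∫ x in (0 : ℝ)..1, f (discretize N x) = (N : ℂ)⁻¹ * ∑ i : Fin N, f (site N i) := by
  have hN' : (0 : ℝ) < N := by exact_mod_cast hN
  have hle : ∀ k : ℕ, (k : ℝ) / N ≤ ((k + 1 : ℕ) : ℝ) / N := fun k => by
    gcongr; simp
  have heq : ∀ k : ℕ, ∀ x ∈ Set.Ioc ((k : ℝ) / N) ((k + 1 : ℕ) / N),
      f (((k : ℝ) + 1) / N) = f (discretize N x) := fun k x hx => by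
    rw [discretize_eq hN hx]
  have hsum := intervalIntegral.sum_integral_adjacent_intervals (n := N) (μ := volume)
    (a := fun k : ℕ => (k : ℝ) / N) (f := fun x => f (discretize N x)) (fun k _ => by
      refine IntervalIntegrable.congr (f := fun _ => f (((k : ℝ) + 1) / N)) ?_
        intervalIntegrable_const
      rw [Set.uIoc_of_le (hle k)]
      exact heq k)
  simp only [Nat.cast_zero, zero_div, div_self hN'.ne'] at hsum
  rw [← hsum, Finset.sum_range, Finset.mul_sum]
  refine Finset.sum_congr rfl fun i _ => ?_
  rw [intervalIntegral.integral_of_le (hle i),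
    ← setIntegral_congr_fun measurableSet_Ioc (heq i),
    ← intervalIntegral.integral_of_le (hle i), intervalIntegral.integral_const]
  have : ((i + 1 : ℕ) : ℝ) / N - (i : ℝ) / N = (N : ℝ)⁻¹ := by
    push_cast; field_simp; ring
  rw [this]
  simp [site]

theorem tendsto_riemann_sum {f : ℝ → ℂ} {C : ℝ} (hC : ∀ x ∈ Set.Icc (0 : ℝ) 1, ‖f x‖ ≤ C)
    (hf : ∀ᵐ x ∂(volume.restrict (Set.Icc (0 : ℝ) 1)), ContinuousWithinAt f (Set.Icc 0 1) x) :
    Tendsto (fun N : ℕ => (N : ℂ)⁻¹ * ∑ i : Fin N, f (site N i)) atTop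
      (𝓝 (∫ x in (0 : ℝ)..1, f x)) := by
  have h : Tendsto (fun N : ℕ => ∫ x in (0 : ℝ)..1, f (discretize N x)) atTop
      (𝓝 (∫ x in (0 : ℝ)..1, f x)) := by
    have hsub : Set.Ioc (0 : ℝ) 1 ⊆ Set.Icc 0 1 := Set.Ioc_subset_Icc_self
    rw [ae_restrict_iff' measurableSet_Icc] at hf
    refine intervalIntegral.tendsto_integral_filter_of_dominated_convergence (fun _ => C)
      (Eventually.of_forall fun N => (measurable_comp_discretize N f).aestronglyMeasurable)
      (Eventually.of_forall fun N => Eventually.of_forall fun x hx => ?_)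
      intervalIntegrable_const ?_
    · rw [Set.uIoc_of_le zero_le_one] at hx
      exact hC _ (discretize_mem (hsub hx))
    · filter_upwards [hf] with x hx hx01
      rw [Set.uIoc_of_le zero_le_one] at hx01
      exact (hx (hsub hx01)).tendsto.comp (tendsto_discretize (hsub hx01))
  refine h.congr' ?_
  filter_upwards [eventually_gt_atTop 0] with N hN
  exact integral_discretize hN f

theorem tendsto_riemann_sum₂ {F : ℝ → ℝ → ℂ} {C : ℝ}
    (hC : ∀ x ∈ Set.Icc (0 : ℝ) 1, ∀ y ∈ Set.Icc (0 : ℝ) 1, ‖F x y‖ ≤ C)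
    (hF : ∀ᵐ x ∂(volume.restrict (Set.Icc (0 : ℝ) 1)),
      ∀ᵐ y ∂(volume.restrict (Set.Icc (0 : ℝ) 1)),
        ContinuousWithinAt (fun p : ℝ × ℝ => F p.1 p.2) (Set.Icc 0 1 ×ˢ Set.Icc 0 1) (x, y)) :
    Tendsto (fun N : ℕ => (N : ℂ)⁻¹ * ∑ i : Fin N, ((N : ℂ)⁻¹ * ∑ j : Fin N,
      F (site N i) (site N j))) atTop
      (𝓝 (∫ x in (0 : ℝ)..1, ∫ y in (0 : ℝ)..1, F x y)) := by
  have hsub : Set.Ioc (0 : ℝ) 1 ⊆ Set.Icc 0 1 := Set.Ioc_subset_Icc_self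
  have h : Tendsto (fun N : ℕ => ∫ x in (0 : ℝ)..1, ∫ y in (0 : ℝ)..1,
      F (discretize N x) (discretize N y)) atTop
      (𝓝 (∫ x in (0 : ℝ)..1, ∫ y in (0 : ℝ)..1, F x y)) := by
    rw [ae_restrict_iff' measurableSet_Icc] at hF
    refine intervalIntegral.tendsto_integral_filter_of_dominated_convergence (fun _ => C)
      (Eventually.of_forall fun N => (measurable_comp_discretize N
        (fun t => ∫ y in (0 : ℝ)..1, F t (discretize N y))).aestronglyMeasurable)
      (Eventually.of_forall fun N => Eventually.of_forall fun x hx => ?_)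
      intervalIntegrable_const ?_
    · rw [Set.uIoc_of_le zero_le_one] at hx
      have := intervalIntegral.norm_integral_le_of_norm_le_const (a := (0 : ℝ)) (b := 1) (C := C)
        (f := fun y => F (discretize N x) (discretize N y)) (fun y hy => by
          rw [Set.uIoc_of_le zero_le_one] at hy
          exact hC _ (discretize_mem (hsub hx)) _ (discretize_mem (hsub hy)))
      simpa using this
    · filter_upwards [hF] with x hx hx01
      rw [Set.uIoc_of_le zero_le_one] at hx01
      have hy := hx (hsub hx01)
      rw [ae_restrict_iff' measurableSet_Icc] at hy
      refine intervalIntegral.tendsto_integral_filter_of_dominated_convergence (fun _ => C)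
        (Eventually.of_forall fun N => (measurable_comp_discretize N
          (F (discretize N x))).aestronglyMeasurable)
        (Eventually.of_forall fun N => Eventually.of_forall fun y hy => ?_)
        intervalIntegrable_const ?_
      · rw [Set.uIoc_of_le zero_le_one] at hy
        exact hC _ (discretize_mem (hsub hx01)) _ (discretize_mem (hsub hy))
      · filter_upwards [hy] with y hy hy01
        rw [Set.uIoc_of_le zero_le_one] at hy01
        have h2 := (tendsto_discretize (hsub hx01)).prodMk (tendsto_discretize (hsub hy01))
        rw [← nhdsWithin_prod_eq] at h2
        exact (hy (hsub hy01)).tendsto.comp h2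
  refine h.congr' ?_
  filter_upwards [eventually_gt_atTop 0] with N hN
  rw [integral_discretize hN (fun t => ∫ y in (0 : ℝ)..1, F t (discretize N y))]
  simp only [integral_discretize hN]

/-! ### Traces of products as sums over closed paths -/

/-- Closes a path into a cycle: when the last vertex equals the first, the list of end points of the
steps is the rotation of the list of their starting points. -/
theorem snoc_eq_cons_finRotate {V : Type*} {n : ℕ} (x : V) (i : Fin n → V) (k : Fin (n + 1)) :
    Fin.snoc (α := fun _ => V) i x k = Fin.cons (α := fun _ => V) x i (finRotate (n + 1) k) := by
  refine Fin.lastCases ?_ (fun j => ?_) k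
  · rw [finRotate_last]; simp
  · rw [finRotate_apply, Fin.coeSucc_eq_succ]; simp

section Trace

variable {V R : Type*} [Fintype V] [DecidableEq V] [CommRing R]

theorem list_prod_ofFn_apply {n : ℕ} (B : Fin (n + 1) → Matrix V V R) (x y : V) :
    (List.ofFn B).prod x y = ∑ i : Fin n → V,
      ∏ k, B k (Fin.cons (α := fun _ => V) x i k) (Fin.snoc (α := fun _ => V) i y k) := by
  induction n generalizing x with
  | zero =>
    simp [Fin.snoc]
  | succ n ih =>
    rw [List.ofFn_succ, List.prod_cons, Matrix.mul_apply]
    simp only [ih, Finset.mul_sum]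
    rw [← Fintype.sum_prod_type', ← (Fin.consEquiv fun _ : Fin (n + 1) => V).sum_comp]
    refine Finset.sum_congr rfl fun p _ => ?_
    obtain ⟨z, i⟩ := p
    conv_rhs => rw [Fin.prod_univ_succ]
    simp only [Fin.consEquiv, Equiv.coe_fn_mk]
    rw [← Fin.cons_snoc_eq_snoc_cons]
    simp only [Fin.cons_zero, Fin.cons_succ]

theorem trace_list_prod_ofFn {n : ℕ} (hn : 1 ≤ n) (B : Fin n → Matrix V V R) :
    (List.ofFn B).prod.trace = ∑ i : Fin n → V, ∏ k, B k (i k) (i (finRotate n k)) := by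
  obtain ⟨n, rfl⟩ := Nat.exists_eq_succ_of_ne_zero (Nat.one_le_iff_ne_zero.1 hn)
  simp only [Matrix.trace, Matrix.diag_apply, Nat.succ_eq_add_one, list_prod_ofFn_apply]
  rw [← Fintype.sum_prod_type', ← (Fin.consEquiv fun _ : Fin (n + 1) => V).sum_comp]
  refine Finset.sum_congr rfl fun p _ => Finset.prod_congr rfl fun k _ => ?_
  rw [snoc_eq_cons_finRotate]
  rfl

theorem trace_mul_pow_comm (X Y : Matrix V V R) (n : ℕ) :
    ((X * Y) ^ n).trace = ((Y * X) ^ n).trace := by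
  have h : ∀ n, (X * Y) ^ (n + 1) = X * ((Y * X) ^ n * Y) := by
    intro n
    induction n with
    | zero => simp
    | succ n ih => rw [pow_succ', ih, pow_succ']; simp only [mul_assoc]
  cases n with
  | zero => simp
  | succ n => rw [h, Matrix.trace_mul_comm, mul_assoc, ← pow_succ]

end Trace

/-! ### Expectations of loops -/

/-- The rotation is a single cycle, so no proper nonempty subset is stable under it. -/
theorem exists_finRotate_notMem {n : ℕ} {B : Finset (Fin n)} (hne : B.Nonempty)
    (hB : B ≠ Finset.univ) : ∃ b ∈ B, finRotate n b ∉ B := by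
  by_contra! h
  obtain ⟨b, hb⟩ := hne
  obtain ⟨m, rfl⟩ : ∃ m, n = m + 1 := ⟨n - 1, by have := b.2; omega⟩
  refine hB (Finset.eq_univ_of_forall fun c => ?_)
  have hk : ∀ d : Fin (m + 1), b + d ∈ B := by
    intro d
    induction d using Fin.induction with
    | zero => simpa using hb
    | succ d ih =>
      have := h _ ih
      rwa [finRotate_apply, add_assoc, Fin.coeSucc_eq_succ] at this
  have := hk (c - b)
  rwa [add_sub_cancel] at this

section Ensemble

variable {P : ∀ N : ℕ, Measure (Fin N → Fin N → ℂ)} {g : ∀ n : ℕ, (Fin n → ℝ) → ℂ}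

theorem IsEnsemble.integrable_prod (hP : IsEnsemble P g) {N : ℕ} {κ : Type*} (s : Finset κ)
    (u v : κ → Fin N) : Integrable (fun A => ∏ k ∈ s, A (u k) (v k)) (P N) := by
  have := hP.prob N
  rcases s.eq_empty_or_nonempty with rfl | hs
  · simp
  have h := MemLp.prod' (s := s) (μ := P N) (p := fun _ => ((s.card : ℕ) : ENNReal))
    (f := fun k A => A (u k) (v k)) (fun k _ => by simpa using hP.moments N s.card (u k) (v k))
  refine memLp_one_iff_integrable.1 ?_
  convert h using 1
  have : (s.card : ENNReal) ≠ 0 := by simpa using hs.ne_empty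
  simp [ENNReal.mul_inv_cancel this (ENNReal.natCast_ne_top _)]

theorem IsEnsemble.integrable_loop (hP : IsEnsemble P g) {N n : ℕ} (i : Fin n → Fin N) :
    Integrable (loop i) (P N) :=
  hP.integrable_prod Finset.univ i fun k => i (finRotate n k)

/-- Give the vertex `i (finRotate n b)` the phase `-1`, that is, the angle `π`. The factor `b` ends
there, while the factor starting there is missing from the product, so the product changes sign
although the law is invariant. -/
theorem IsEnsemble.integral_prod_loopEntry (hP : IsEnsemble P g) {N n : ℕ} {i : Fin n → Fin N}
    (hi : Function.Injective i) {B : Finset (Fin n)} {b : Fin n} (hb : b ∈ B)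
    (hrb : finRotate n b ∉ B) : ∫ A, ∏ k ∈ B, loopEntry i k A ∂P N = 0 := by
  set θ : Fin N → ℝ := fun v => if v = i (finRotate n b) then Real.pi else 0 with hθ
  set T : (Fin N → Fin N → ℂ) → (Fin N → Fin N → ℂ) := fun A i j =>
      Complex.exp (-(Complex.I * θ i)) * A i j * Complex.exp (Complex.I * θ j) with hT
  have hTm : Measurable T := by
    refine measurable_pi_lambda _ fun i => measurable_pi_lambda _ fun j => ?_
    have : Measurable fun A : Fin N → Fin N → ℂ => A i j :=
      (measurable_pi_apply j).comp (measurable_pi_apply i)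
    exact (this.const_mul _).mul_const _
  have hfm : Measurable fun A : Fin N → Fin N → ℂ => ∏ k ∈ B, loopEntry i k A := by
    refine Finset.measurable_prod _ fun k _ => ?_
    exact (measurable_pi_apply _).comp (measurable_pi_apply _)
  have hTf : ∀ A, ∏ k ∈ B, loopEntry i k (T A) = -∏ k ∈ B, loopEntry i k A := by
    intro A
    have : ∀ k ∈ B, loopEntry i k (T A) = (if k = b then -1 else 1) * loopEntry i k A := by
      intro k hk
      have h1 : i k ≠ i (finRotate n b) := fun h => hrb (hi h ▸ hk)
      have h2 : i (finRotate n k) = i (finRotate n b) ↔ k = b := by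
        rw [hi.eq_iff, (finRotate n).injective.eq_iff]
      simp only [loopEntry, hT, hθ, h1, h2, if_false]
      split_ifs
      · rw [mul_comm Complex.I (Real.pi : ℂ), Complex.exp_pi_mul_I]; simp
      · simp
    rw [Finset.prod_congr rfl this, Finset.prod_mul_distrib, Finset.prod_ite_eq' B b]
    simp [hb]
  have h1 : ∫ A, ∏ k ∈ B, loopEntry i k A ∂P N =
      ∫ A, ∏ k ∈ B, loopEntry i k (T A) ∂P N := by
    conv_lhs => rw [← hP.invariance N θ]
    exact integral_map hTm.aemeasurable hfm.aestronglyMeasurable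
  simp only [hTf, integral_neg] at h1
  exact self_eq_neg.1 h1

/-- For distinct indices, the moment of a loop is equal to its cumulant. -/
theorem IsEnsemble.jointCumulant_eq (hP : IsEnsemble P g) {N n : ℕ} (hn : 1 ≤ n)
    {i : Fin n → Fin N} (hi : Function.Injective i) :
    jointCumulant (P N) (loopEntry i) = ∫ A, loop i A ∂P N := by
  have hne : (Finset.univ : Finset (Fin n)) ≠ ⊥ := by
    have : NeZero n := ⟨by omega⟩
    exact Finset.univ_nonempty.ne_empty
  rw [jointCumulant, Finset.sum_eq_single (Finpartition.indiscrete hne)]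
  · simp [Finpartition.indiscrete, loop]
  -- A partition with more than one block has a block that is an open piece of the loop, and the
  -- expectation of that block vanishes.
  · intro π _ hπ
    have : ∃ B ∈ π.parts, B ≠ Finset.univ := by
      by_contra! h
      refine hπ (Finpartition.ext ?_)
      obtain ⟨B, hB⟩ := π.parts_nonempty hne
      ext C
      simp only [Finpartition.indiscrete, Finset.mem_singleton]
      exact ⟨fun hC => h C hC, fun hC => by rwa [hC.trans (h B hB).symm]⟩
    obtain ⟨B, hB, hBu⟩ := this
    obtain ⟨b, hb, hrb⟩ := exists_finRotate_notMem (π.nonempty_of_mem_parts hB) hBu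
    rw [Finset.prod_eq_zero hB (hP.integral_prod_loopEntry hi hb hrb), mul_zero]
  · simp

theorem IsEnsemble.limit_loop (hP : IsEnsemble P g) {n : ℕ} (hn : 1 ≤ n) {ε : ℝ} (hε : 0 < ε) :
    ∀ᶠ N in atTop, ∀ i : Fin n → Fin N, Function.Injective i →
      ‖(N : ℂ) ^ (n - 1) * ∫ A, loop i A ∂P N - g n (fun k => site N (i k))‖ < ε := by
  filter_upwards [hP.limit n hn ε hε] with N h i hi
  rw [← hP.jointCumulant_eq hn hi]
  exact h i hi

/-- The expectation of the normalized trace of `χ₁ M χ₂ M ⋯ χₙ M`, as a sum over loops. -/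
def wordMoment (P : ∀ N : ℕ, Measure (Fin N → Fin N → ℂ)) {n : ℕ} (χ : Fin n → ℝ → ℝ)
    (N : ℕ) : ℂ :=
  (N : ℂ)⁻¹ * ∑ i : Fin n → Fin N, (∏ k, (χ k (site N (i k)) : ℂ)) * ∫ A, loop i A ∂P N

theorem ntr_prod_diagMat_mul {N n : ℕ} (hn : 1 ≤ n) (χ : Fin n → ℝ → ℝ)
    (A : Fin N → Fin N → ℂ) :
    ntr (List.ofFn fun k => diagMat N (χ k) * Matrix.of A).prod =
      (N : ℂ)⁻¹ * ∑ i : Fin n → Fin N, (∏ k, (χ k (site N (i k)) : ℂ)) * loop i A := by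
  rw [ntr, trace_list_prod_ofFn hn]
  congr 1
  refine Finset.sum_congr rfl fun i _ => ?_
  rw [loop, ← Finset.prod_mul_distrib]
  refine Finset.prod_congr rfl fun k _ => ?_
  simp [diagMat, Matrix.diagonal_mul, loopEntry]

theorem IsEnsemble.integral_ntr_prod (hP : IsEnsemble P g) {N n : ℕ} (hn : 1 ≤ n)
    (χ : Fin n → ℝ → ℝ) :
    ∫ A, ntr (List.ofFn fun k => diagMat N (χ k) * Matrix.of A).prod ∂P N =
      wordMoment P χ N := by
  simp only [ntr_prod_diagMat_mul hn]
  rw [integral_const_mul, integral_finsetSum _ fun i _ => (hP.integrable_loop i).const_mul _]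
  simp only [integral_const_mul]
  rfl

theorem site_mem (N : ℕ) (i : Fin N) : site N i ∈ Set.Icc (0 : ℝ) 1 := by
  have hN : (0 : ℝ) < N := by exact_mod_cast (Nat.zero_le _).trans_lt i.2
  have hi : (i : ℝ) + 1 ≤ N := by exact_mod_cast i.2
  refine ⟨?_, ?_⟩
  · unfold site; positivity
  · rw [site, div_le_one hN]; exact hi

theorem compressed_eq {N : ℕ} {h : ℝ → ℝ} (hh : ∀ x ∈ Set.Icc (0 : ℝ) 1, 0 ≤ h x)
    (A : Fin N → Fin N → ℂ) (n : ℕ) :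
    (compressed h A ^ n).trace = ((diagMat N h * Matrix.of A) ^ n).trace := by
  rw [compressed, trace_mul_pow_comm, ← mul_assoc]
  congr 3
  rw [diagMat, Matrix.diagonal_mul_diagonal, diagMat]
  congr 1
  ext i
  rw [← Complex.ofReal_mul, Real.mul_self_sqrt (hh _ (site_mem N i))]

theorem IsEnsemble.integral_ntr_compressed (hP : IsEnsemble P g) {N n : ℕ} (hn : 1 ≤ n)
    {h : ℝ → ℝ} (hh : ∀ x ∈ Set.Icc (0 : ℝ) 1, 0 ≤ h x) :
    ∫ A, ntr (compressed h A ^ n) ∂P N = wordMoment P (fun _ : Fin n => h) N := by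
  rw [← hP.integral_ntr_prod hn]
  simp only [ntr, compressed_eq hh, List.ofFn_const, List.prod_replicate]

/-- Cyclicity of the trace; it makes `g n` invariant under rotation of its arguments. -/
theorem wordMoment_finRotate {n : ℕ} (χ : Fin n → ℝ → ℝ) (N : ℕ) :
    wordMoment P (fun k => χ (finRotate n k)) N = wordMoment P χ N := by
  simp only [wordMoment]
  congr 1
  rw [← (Equiv.arrowCongr (finRotate n) (Equiv.refl (Fin N))).symm.sum_comp]
  refine Finset.sum_congr rfl fun i _ => ?_
  have h2 : loop ((Equiv.arrowCongr (finRotate n) (Equiv.refl (Fin N))).symm i) = loop i := by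
    funext A
    simp only [loop, loopEntry]
    exact Equiv.prod_comp (finRotate n) fun k => A (i k) (i (finRotate n k))
  rw [h2]
  congr 1
  exact Equiv.prod_comp (finRotate n) fun k => ((χ k (site N (i k)) : ℝ) : ℂ)

/-- The `n`-th moment of `M_h` is homogeneous of degree `n` in `h`, so polarization leaves the words
in which each `χ c` occurs exactly once. -/
theorem sum_neg_one_pow_wordMoment {n : ℕ} (χ : Fin n → ℝ → ℝ) (N : ℕ) :
    ∑ U : Finset (Fin n), (-1 : ℂ) ^ U.card *
        wordMoment P (fun _ : Fin n => fun x => ∑ c ∈ Uᶜ, χ c x) N =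
      ∑ τ : Equiv.Perm (Fin n), wordMoment P (fun k => χ (τ k)) N := by
  simp only [wordMoment, ← Finset.mul_sum]
  simp only [mul_left_comm _ (N : ℂ)⁻¹, ← Finset.mul_sum]
  congr 1
  simp only [Finset.mul_sum]
  rw [Finset.sum_comm, Finset.sum_comm (t := (Finset.univ : Finset (Fin n → Fin N)))]
  refine Finset.sum_congr rfl fun i _ => ?_
  simp only [← mul_assoc, ← Finset.sum_mul]
  congr 1
  have := sum_neg_one_pow_prod_sum_compl (R := ℂ) (j := n)
    fun k c => ((χ c (site N (i k)) : ℝ) : ℂ)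
  rw [sum_surjective_eq_sum_perm
    fun f : Fin n → Fin n => ∏ k, ((χ (f k) (site N (i k)) : ℝ) : ℂ)] at this
  push_cast
  exact this

end Ensemble

/-! ### Profiles and indicators of intervals -/

theorem isProfile_const (c : ℝ) : IsProfile fun _ => c :=
  ⟨measurable_const, ⟨|c|, fun _ _ => le_rfl⟩,
    Eventually.of_forall fun _ => continuousWithinAt_const⟩

theorem IsProfile.sum {κ : Type*} {s : Finset κ} {h : κ → ℝ → ℝ}
    (hh : ∀ c ∈ s, IsProfile (h c)) : IsProfile fun x => ∑ c ∈ s, h c x := by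
  classical
  induction s using Finset.induction_on with
  | empty => simpa using isProfile_const 0
  | insert c s hc ih =>
    have h1 := hh c (Finset.mem_insert_self c s)
    have h2 := ih fun c hc => hh c (Finset.mem_insert_of_mem hc)
    simp only [Finset.sum_insert hc]
    obtain ⟨C₁, hC₁⟩ := h1.bounded
    obtain ⟨C₂, hC₂⟩ := h2.bounded
    refine ⟨h1.measurable.add h2.measurable, ⟨C₁ + C₂, fun x hx =>
      (abs_add_le _ _).trans (add_le_add (hC₁ x hx) (hC₂ x hx))⟩, ?_⟩
    filter_upwards [h1.ae_continuous, h2.ae_continuous] with x hx₁ hx₂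
    exact hx₁.add hx₂

theorem IsProfile.tendsto_mean {h : ℝ → ℝ} (hh : IsProfile h) :
    Tendsto (fun N : ℕ => (N : ℝ)⁻¹ * ∑ i : Fin N, h (site N i)) atTop
      (𝓝 (∫ x in (0 : ℝ)..1, h x)) := by
  obtain ⟨C, hC⟩ := hh.bounded
  have := tendsto_riemann_sum (f := fun x => (h x : ℂ)) (C := C)
    (fun x hx => by simpa using hC x hx)
    (hh.ae_continuous.mono fun x hx =>
      Complex.continuous_ofReal.continuousAt.comp_continuousWithinAt hx)
  rw [intervalIntegral.integral_ofReal] at this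
  have h2 := (Complex.continuous_re.tendsto _).comp this
  rw [Complex.ofReal_re] at h2
  refine h2.congr fun N => ?_
  rw [Function.comp_apply, ← Complex.ofReal_natCast, ← Complex.ofReal_inv, ← Complex.ofReal_sum,
    ← Complex.ofReal_mul, Complex.ofReal_re]

/-- The indicator of the interval of radius `δ` around `c`. -/
def bump (c δ : ℝ) : ℝ → ℝ := (Set.Ioo (c - δ) (c + δ)).indicator fun _ => 1

theorem bump_of_mem {c δ x : ℝ} (h : |x - c| < δ) : bump c δ x = 1 := by
  rw [abs_lt] at h
  exact Set.indicator_of_mem (Set.mem_Ioo.2 ⟨by linarith, by linarith⟩) _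

theorem bump_of_notMem {c δ x : ℝ} (h : ¬|x - c| < δ) : bump c δ x = 0 := by
  refine Set.indicator_of_notMem (fun hx => h ?_) _
  rw [abs_lt]
  exact ⟨by linarith [hx.1], by linarith [hx.2]⟩

theorem bump_nonneg (c δ x : ℝ) : 0 ≤ bump c δ x :=
  Set.indicator_nonneg (fun _ _ => zero_le_one) _

theorem bump_le_one (c δ x : ℝ) : bump c δ x ≤ 1 :=
  Set.indicator_le_self' (fun _ _ => zero_le_one) _

theorem isProfile_bump (c δ : ℝ) : IsProfile (bump c δ) := by
  refine ⟨measurable_const.indicator measurableSet_Ioo, ⟨1, fun x _ => ?_⟩, ?_⟩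
  · rw [abs_of_nonneg (bump_nonneg c δ x)]
    exact bump_le_one c δ x
  · refine ae_restrict_of_ae ?_
    have h1 : ∀ᵐ x ∂(volume : Measure ℝ), x ≠ c - δ := Measure.ae_ne volume _
    have h2 : ∀ᵐ x ∂(volume : Measure ℝ), x ≠ c + δ := Measure.ae_ne volume _
    filter_upwards [h1, h2] with x hx₁ hx₂
    refine (continuousOn_const.continuousAt_indicator fun hx => ?_).continuousWithinAt
    by_cases h : c - δ < c + δ
    · rw [frontier_Ioo h] at hx
      rcases hx with hx | hx
      · exact hx₁ hx
      · exact hx₂ hx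
    · rw [Set.Ioo_eq_empty h] at hx
      simp at hx

theorem integral_bump {c δ : ℝ} (hδ : 0 ≤ δ) (h₁ : δ ≤ c) (h₂ : c + δ ≤ 1) :
    ∫ x in (0 : ℝ)..1, bump c δ x = 2 * δ := by
  rw [intervalIntegral.integral_of_le zero_le_one]
  unfold bump
  have hsub : Set.Ioo (c - δ) (c + δ) ⊆ Set.Ioc 0 1 := fun x hx =>
    ⟨by linarith [hx.1], by linarith [hx.2]⟩
  rw [setIntegral_indicator measurableSet_Ioo, setIntegral_const, smul_eq_mul, mul_one,
    Set.inter_eq_self_of_subset_right hsub, Real.volume_real_Ioo_of_le (by linarith)]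
  ring

/-- The intervals of radius `δ` around the points `x k` are disjoint and contained in `[0, 1]`. -/
structure IsSmallRadius {n : ℕ} (x : Fin n → ℝ) (δ : ℝ) : Prop where
  pos : 0 < δ
  le : ∀ k, δ ≤ x k
  add_le : ∀ k, x k + δ ≤ 1
  separated : ∀ k j, k ≠ j → 2 * δ ≤ |x k - x j|

theorem eventually_isSmallRadius {n : ℕ} {x : Fin n → ℝ} (hx : x ∈ genericCube n) :
    ∀ᶠ δ in 𝓝[>] (0 : ℝ), IsSmallRadius x δ := by
  have h0 : ∀ᶠ δ in 𝓝[>] (0 : ℝ), 0 < δ := eventually_mem_nhdsWithin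
  have hlt : ∀ {a : ℝ}, 0 < a → ∀ᶠ δ in 𝓝[>] (0 : ℝ), δ < a := fun ha =>
    (eventually_lt_nhds ha).filter_mono nhdsWithin_le_nhds
  have h1 : ∀ᶠ δ in 𝓝[>] (0 : ℝ), ∀ k, δ < x k := eventually_all.2 fun k => hlt (hx.2 k).1
  have h2 : ∀ᶠ δ in 𝓝[>] (0 : ℝ), ∀ k, δ < 1 - x k :=
    eventually_all.2 fun k => hlt (sub_pos.2 (hx.2 k).2)
  have h3 : ∀ᶠ δ in 𝓝[>] (0 : ℝ), ∀ p : Fin n × Fin n, p.1 ≠ p.2 →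
      δ < |x p.1 - x p.2| / 2 := eventually_all.2 fun p => by
    by_cases hp : p.1 = p.2
    · simp [hp]
    · filter_upwards [hlt (half_pos (abs_pos.2 (sub_ne_zero.2 (hx.1.ne hp))))] with δ h _
      exact h
  filter_upwards [h0, h1, h2, h3] with δ h0 h1 h2 h3
  exact ⟨h0, fun k => (h1 k).le, fun k => by linarith [h2 k], fun k j hkj => by
    linarith [h3 (k, j) hkj]⟩

theorem IsSmallRadius.eq_of_bump {n : ℕ} {x : Fin n → ℝ} {δ : ℝ} (h : IsSmallRadius x δ)
    {k j : Fin n} {y : ℝ} (hk : |y - x k| < δ) (hj : |y - x j| < δ) : k = j := by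
  by_contra hkj
  have h1 := h.separated k j hkj
  have h2 : |x k - x j| ≤ |y - x k| + |y - x j| := by
    have := abs_sub (y - x j) (y - x k)
    rw [show y - x j - (y - x k) = x k - x j by ring] at this
    linarith
  linarith

theorem IsSmallRadius.bump_mul {n : ℕ} {x : Fin n → ℝ} {δ : ℝ} (h : IsSmallRadius x δ)
    {k j : Fin n} (hkj : k ≠ j) (y : ℝ) : bump (x k) δ y * bump (x j) δ y = 0 := by
  by_cases hk : |y - x k| < δ
  · rw [bump_of_notMem fun hj => hkj (h.eq_of_bump hk hj), mul_zero]
  · rw [bump_of_notMem hk, zero_mul]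

/-- Such sums are projections, so all their moments equal their trace, as `IsFreeProjPair` requires.
-/
theorem IsSmallRadius.sum_bump {n : ℕ} {x : Fin n → ℝ} {δ : ℝ} (h : IsSmallRadius x δ)
    (S : Finset (Fin n)) (y : ℝ) :
    ∑ c ∈ S, bump (x c) δ y = 0 ∨ ∑ c ∈ S, bump (x c) δ y = 1 := by
  by_cases hy : ∃ c ∈ S, |y - x c| < δ
  · obtain ⟨c, hc, hyc⟩ := hy
    right
    rw [Finset.sum_eq_single_of_mem c hc fun b _ hb =>
      bump_of_notMem fun hyb => hb (h.eq_of_bump hyb hyc), bump_of_mem hyc]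
  · push Not at hy
    left
    exact Finset.sum_eq_zero fun c hc => bump_of_notMem (not_lt.2 (hy c hc))

/-! ### Localized words -/

section Localized

variable {P : ∀ N : ℕ, Measure (Fin N → Fin N → ℂ)} {g : ∀ n : ℕ, (Fin n → ℝ) → ℂ}

theorem inv_mul_eq_pow {N n : ℕ} (hN : 0 < N) (hn : 1 ≤ n) (z : ℂ) :
    (N : ℂ)⁻¹ * z = ((N : ℂ)⁻¹) ^ n * ((N : ℂ) ^ (n - 1) * z) := by
  obtain ⟨m, rfl⟩ := Nat.exists_eq_succ_of_ne_zero (Nat.one_le_iff_ne_zero.1 hn)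
  have : (N : ℂ) ≠ 0 := by exact_mod_cast hN.ne'
  rw [Nat.succ_sub_one, pow_succ, inv_pow]
  field_simp

/-- The words `χ₁ M χ₂ M ⋯ χₙ M`, where the `χ k` are the indicators of small disjoint intervals,
only see the values of `g n` close to the centers of these intervals. -/
theorem IsEnsemble.wordMoment_bump (hP : IsEnsemble P g) {n : ℕ} (hn : 1 ≤ n)
    {x : Fin n → ℝ} (hx : x ∈ genericCube n) {ε : ℝ} (hε : 0 < ε) :
    ∀ᶠ δ in 𝓝[>] (0 : ℝ), ∀ᶠ N in atTop,
      ‖wordMoment P (fun k => bump (x k) δ) N - ((2 * δ : ℝ) : ℂ) ^ n * g n x‖ ≤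
        ε * (2 * δ) ^ n := by
  obtain ⟨η, hη, hcont⟩ := Metric.continuousWithinAt_iff.1
    (hP.continuous n hn x (genericCube_subset n hx)) (ε / 4) (by positivity)
  have hlt : ∀ᶠ δ in 𝓝[>] (0 : ℝ), δ < η :=
    (eventually_lt_nhds hη).filter_mono nhdsWithin_le_nhds
  filter_upwards [eventually_isSmallRadius hx, hlt] with δ hδ hδη
  -- `q N` is the total weight of the paths through the intervals, scaled by `N^(-n)`. It tends to
  -- `(2δ)^n`, so it suffices to compare the moment with `q N * g n x` path by path, with error `ε /
  -- 2` per unit of weight.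
  set q : ℕ → ℝ := fun N => ∏ k, ((N : ℝ)⁻¹ * ∑ j : Fin N, bump (x k) δ (site N j)) with hq
  have hqlim : Tendsto q atTop (𝓝 ((2 * δ) ^ n)) := by
    have := tendsto_finsetProd (Finset.univ : Finset (Fin n)) fun k _ =>
      (isProfile_bump (x k) δ).tendsto_mean
    simpa [integral_bump hδ.pos.le (hδ.le _) (hδ.add_le _)] using this
  have hqsum : ∀ N, q N = ((N : ℝ)⁻¹) ^ n *
      ∑ i : Fin n → Fin N, ∏ k, bump (x k) δ (site N (i k)) := fun N => by
    rw [hq]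
    dsimp only
    rw [Finset.prod_mul_distrib, Finset.prod_const, Finset.card_univ, Fintype.card_fin,
      Finset.prod_univ_sum, Fintype.piFinset_univ]
  have hq2 : Tendsto (fun N => ε / 2 * q N + |q N - (2 * δ) ^ n| * ‖g n x‖) atTop
      (𝓝 (ε / 2 * (2 * δ) ^ n + |(2 * δ) ^ n - (2 * δ) ^ n| * ‖g n x‖)) :=
    (hqlim.const_mul _).add ((hqlim.sub_const _).abs.mul_const _)
  have hpos : 0 < (2 * δ) ^ n := by have := hδ.pos; positivity
  have hev := hq2.eventually_lt_const (u := ε * (2 * δ) ^ n) (by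
    simp only [sub_self, abs_zero, zero_mul, add_zero]; nlinarith)
  filter_upwards [hev, hP.limit_loop hn (ε := ε / 4) (by positivity), eventually_gt_atTop 0]
    with N hN hloop hN0
  refine le_trans ?_ hN.le
  have hdiff : wordMoment P (fun k => bump (x k) δ) N - (q N : ℂ) * g n x =
      ((N : ℂ)⁻¹) ^ n * ∑ i : Fin n → Fin N, (∏ k, (bump (x k) δ (site N (i k)) : ℂ)) *
        ((N : ℂ) ^ (n - 1) * (∫ A, loop i A ∂P N) - g n x) := by
    rw [wordMoment, inv_mul_eq_pow hN0 hn, hqsum]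
    push_cast
    rw [mul_assoc, ← mul_sub, Finset.sum_mul, Finset.mul_sum, ← Finset.sum_sub_distrib]
    congr 1
    refine Finset.sum_congr rfl fun i _ => by ring
  have hterm : ∀ i : Fin n → Fin N, ‖(∏ k, (bump (x k) δ (site N (i k)) : ℂ)) *
      ((N : ℂ) ^ (n - 1) * (∫ A, loop i A ∂P N) - g n x)‖ ≤
        (∏ k, bump (x k) δ (site N (i k))) * (ε / 2) := by
    intro i
    have hnn : 0 ≤ ∏ k, bump (x k) δ (site N (i k)) :=
      Finset.prod_nonneg fun k _ => bump_nonneg _ _ _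
    rw [norm_mul, ← Complex.ofReal_prod, Complex.norm_real, Real.norm_of_nonneg hnn]
    -- Either the path visits the intervals in order, so that its indices are distinct and close to
    -- `x`, or its weight is zero.
    by_cases hi : ∀ k, |site N (i k) - x k| < δ
    · refine mul_le_mul_of_nonneg_left ?_ hnn
      have hinj : Function.Injective i := fun k j hkj => hδ.eq_of_bump (hi k) (hkj ▸ hi j)
      have h1 := hloop i hinj
      have h2 := hcont (x := fun k => site N (i k))
        ⟨fun k => (site_mem N (i k)).1, fun k => (site_mem N (i k)).2⟩
        ((dist_pi_lt_iff hη).2 fun k => by rw [Real.dist_eq]; exact (hi k).trans hδη)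
      rw [dist_eq_norm] at h2
      have := norm_sub_le_norm_sub_add_norm_sub
        ((N : ℂ) ^ (n - 1) * (∫ A, loop i A ∂P N)) (g n fun k => site N (i k)) (g n x)
      linarith
    · push Not at hi
      obtain ⟨k, hk⟩ := hi
      rw [Finset.prod_eq_zero (Finset.mem_univ k) (bump_of_notMem (not_lt.2 hk))]
      simp
  have hbound : ‖wordMoment P (fun k => bump (x k) δ) N - (q N : ℂ) * g n x‖ ≤ ε / 2 * q N := by
    rw [hdiff, norm_mul, hqsum, norm_pow, norm_inv, Complex.norm_natCast, mul_left_comm]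
    refine mul_le_mul_of_nonneg_left ?_ (by positivity)
    refine (norm_sum_le _ _).trans ((Finset.sum_le_sum fun i _ => hterm i).trans ?_)
    rw [← Finset.sum_mul, mul_comm]
  have h2 := norm_sub_le_norm_sub_add_norm_sub (wordMoment P (fun k => bump (x k) δ) N)
    ((q N : ℂ) * g n x) (((2 * δ : ℝ) : ℂ) ^ n * g n x)
  have h3 : ‖(q N : ℂ) * g n x - ((2 * δ : ℝ) : ℂ) ^ n * g n x‖ =
      |q N - (2 * δ) ^ n| * ‖g n x‖ := by
    rw [← sub_mul, norm_mul, ← Complex.ofReal_pow, ← Complex.ofReal_sub, Complex.norm_real,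
      Real.norm_eq_abs]
  linarith

end Localized

/-! ### The spectral measure of `M_h` -/

section NotFree

variable {P : ∀ N : ℕ, Measure (Fin N → Fin N → ℂ)} {g : ∀ n : ℕ, (Fin n → ℝ) → ℂ}

theorem compressed_one {N : ℕ} (A : Fin N → Fin N → ℂ) :
    compressed (fun _ => 1) A = Matrix.of A := by
  simp [compressed, diagMat]

theorem prod_map_letterMat {T : Set (ℝ → ℝ)} {N : ℕ} (A : Fin N → Fin N → ℂ)
    {n : ℕ} (χ : Fin n → T) :
    (((List.ofFn fun k => [some (χ k), none]).flatten).map (letterMat A)).prod =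
      (List.ofFn fun k => diagMat N (χ k).1 * Matrix.of A).prod := by
  simp only [List.map_flatten, List.prod_flatten, List.map_ofFn]
  congr 2
  funext k
  simp [letterMat]

theorem prod_map_elim {T : Type*} {A : Type*} [Ring A] (a : A) (ι : T → A) {n : ℕ}
    (χ : Fin n → T) :
    (((List.ofFn fun k => [some (χ k), none]).flatten).map fun o => o.elim a ι).prod =
      (List.ofFn fun k => ι (χ k) * a).prod := by
  simp only [List.map_flatten, List.prod_flatten, List.map_ofFn]
  congr 2
  funext k
  simp

/-- The expectation of the normalized trace of a product of deterministic diagonal matrices. -/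
theorem IsEnsemble.integral_ntr_diag (hP : IsEnsemble P g) {T : Set (ℝ → ℝ)} (N : ℕ)
    (s : List T) :
    ∫ A : Fin N → Fin N → ℂ, ntr ((s.map some).map (letterMat A)).prod ∂P N =
      (((N : ℝ)⁻¹ * ∑ i : Fin N, (s.map fun d => d.1 (site N i)).prod : ℝ) : ℂ) := by
  have := hP.prob N
  have h1 : ∀ A : Fin N → Fin N → ℂ, ((s.map some).map (letterMat A)).prod =
      diagMat N fun x => (s.map fun d => d.1 x).prod := by
    intro A
    induction s with
    | nil => simp [diagMat]
    | cons d s ih =>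
      rw [List.map_cons, List.map_cons, List.prod_cons, ih]
      simp [letterMat, diagMat]
  simp only [h1, integral_const, probReal_univ, one_smul]
  simp [ntr, diagMat, Matrix.trace_diagonal]

theorem integral_pow_profileLaw {h : ℝ → ℝ} (hh : IsProfile h) (k : ℕ) :
    ∫ t, t ^ k ∂(profileLaw h) = ∫ x in (0 : ℝ)..1, h x ^ k := by
  rw [profileLaw, integral_map hh.measurable.aemeasurable
    (by fun_prop : Measurable fun t : ℝ => t ^ k).aestronglyMeasurable,
    intervalIntegral.integral_of_le zero_le_one, integral_Icc_eq_integral_Ioc]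

/-- If `h` is a projection and `M_h` is as if `M` and `h` were free, then the moments of `M_h` are
those of the product of free elements. -/
theorem IsEnsemble.exists_model (hP : IsEnsemble P g) {h : ℝ → ℝ} (hh : IsNonnegProfile h)
    (h01 : ∀ x, h x = 0 ∨ h x = 1)
    (H : (∃ σ σI, IsSpectralMeasure P (fun _ => 1) σ ∧ IsSpectralMeasure P h σI ∧
      IsFreeMulConv (profileLaw h) σ σI) ∨ IsFreeFromDiagonal P {h}) :
    ∃ (A : Type) (_ : Ring A) (_ : Algebra ℂ A) (φ : A →ₗ[ℂ] ℂ) (b a : A),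
      IsFreeProjPair (fun k => φ (a ^ k)) φ b a ((∫ x in (0 : ℝ)..1, h x : ℝ) : ℂ) ∧
      (∀ k, Tendsto (fun N => ∫ A, ntr ((Matrix.of A : Matrix (Fin N) (Fin N) ℂ) ^ k) ∂P N) atTop
        (𝓝 (φ (a ^ k)))) ∧
      ∀ n, 1 ≤ n → Tendsto (wordMoment P fun _ : Fin n => h) atTop (𝓝 (φ ((b * a) ^ n))) := by
  have hpow : ∀ (k : ℕ) (x : ℝ), h x ^ (k + 1) = h x := fun k x => by
    rcases h01 x with hx | hx <;> simp [hx]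
  rcases H with ⟨σ, σI, hσ, hσI, A, _, _, φ, b, a, h1, hfree, hb, ha, hba⟩ |
    ⟨A, _, _, φ, a, ι, h1, hfree, hlim⟩
  · refine ⟨A, _, _, φ, b, a, ⟨h1, hfree.symm, fun k => ?_, fun k => rfl⟩, fun k => ?_,
      fun n hn => ?_⟩
    · rw [(hb (k + 1)).2, integral_pow_profileLaw hh.1]
      simp only [hpow]
    · rw [(ha k).2]
      simpa only [compressed_one] using (hσ k).2
    · rw [(hba n).2]
      refine (hσI n).2.congr fun N => ?_
      exact hP.integral_ntr_compressed hn hh.2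
  · set e : ({h} : Set (ℝ → ℝ)) := ⟨h, rfl⟩ with he
    refine ⟨A, _, _, φ, ι e, a, ⟨h1, ?_, fun k => ?_, fun k => rfl⟩, fun k => ?_,
      fun n hn => ?_⟩
    · convert hfree
      symm
      rw [Set.range_eq_iff]
      refine ⟨fun d => ?_, fun b hb => ⟨e, hb.symm⟩⟩
      rw [show d = e from Subtype.ext d.2]
      rfl
    -- The moments of `b` are read off from words without `M`, whose normalized traces are Riemann
    -- sums of a power of `h`, hence of `h`.
    · have h2 := hlim ((List.replicate (k + 1) e).map some)
      simp only [hP.integral_ntr_diag] at h2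
      simp only [List.map_replicate, List.prod_replicate, Option.elim_some, he, hpow] at h2
      refine tendsto_nhds_unique h2 ?_
      exact (Complex.continuous_ofReal.tendsto _).comp hh.1.tendsto_mean
    · have h2 := hlim (List.replicate k none)
      simpa only [List.map_replicate, List.prod_replicate, letterMat, Option.elim_none] using h2
    · have h2 := hlim (List.ofFn fun _ : Fin n => [some e, none]).flatten
      have h3 : (List.ofFn fun _ : Fin n => ι e * a).prod = (ι e * a) ^ n := by
        rw [List.ofFn_const, List.prod_replicate]
      rw [prod_map_elim a ι fun _ : Fin n => e, h3] at h2
      refine h2.congr fun N => ?_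
      simp only [prod_map_letterMat _ fun _ : Fin n => e]
      exact hP.integral_ntr_prod hn fun _ => h

/-- The constant is the coefficient of degree `n` of the polynomial that free compression prescribes
for the `n`-th moment. -/
theorem IsEnsemble.symmetrize_const (hP : IsEnsemble P g)
    (H : ∀ h : ℝ → ℝ, IsNonnegProfile h →
      (∃ σ σI, IsSpectralMeasure P (fun _ => 1) σ ∧ IsSpectralMeasure P h σI ∧
        IsFreeMulConv (profileLaw h) σ σI) ∨ IsFreeFromDiagonal P {h})
    {n : ℕ} (hn : 1 ≤ n) : IsConstOnCube (symmetrize (g n)) := by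
  -- The projection `h = 0` serves to obtain the limiting moments of `M`. They do not depend on `h`,
  -- so a single polynomial `f` works for all the profiles used below.
  obtain ⟨A₀, _, _, φ₀, b₀, a₀, -, hα, -⟩ := hP.exists_model (h := fun _ => 0)
    ⟨isProfile_const 0, fun _ _ => le_rfl⟩ (fun _ => Or.inl rfl)
    (H _ ⟨isProfile_const 0, fun _ _ => le_rfl⟩)
  obtain ⟨f, hf, hfe⟩ := exists_poly_moment (fun k => φ₀ (a₀ ^ k)) n
  have hfact : (n.factorial : ℂ) ≠ 0 := by exact_mod_cast n.factorial_ne_zero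
  have hgen : ∀ x ∈ genericCube n, symmetrize (g n) x - f.coeff n = 0 := by
    intro x hx
    rw [← norm_le_zero_iff]
    refine le_of_forall_pos_le_add fun ε hε => ?_
    rw [zero_add]
    have hperm : ∀ τ : Equiv.Perm (Fin n), (fun k => x (τ k)) ∈ genericCube n := fun τ =>
      ⟨hx.1.comp τ.injective, fun k => hx.2 (τ k)⟩
    obtain ⟨δ, hδ, happ⟩ := ((eventually_isSmallRadius hx).and
      (eventually_all.2 fun τ : Equiv.Perm (Fin n) =>
        hP.wordMoment_bump hn (hperm τ) hε)).exists
    have hlimU : ∀ U : Finset (Fin n), Tendsto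
        (wordMoment P fun _ : Fin n => fun y => ∑ c ∈ Uᶜ, bump (x c) δ y) atTop
        (𝓝 (f.eval (∑ _c ∈ Uᶜ, ((2 * δ : ℝ) : ℂ)))) := by
      intro U
      have hh : IsNonnegProfile fun y => ∑ c ∈ Uᶜ, bump (x c) δ y :=
        ⟨IsProfile.sum fun c _ => isProfile_bump _ _, fun y _ =>
          Finset.sum_nonneg fun c _ => bump_nonneg _ _ _⟩
      obtain ⟨A, _, _, φ, b, a, hM, hα', hw⟩ := hP.exists_model hh (hδ.sum_bump Uᶜ) (H _ hh)
      have hint : ∫ y in (0 : ℝ)..1, ∑ c ∈ Uᶜ, bump (x c) δ y = ∑ _c ∈ Uᶜ, 2 * δ := by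
        rw [intervalIntegral.integral_finsetSum fun c _ => ?_]
        · exact Finset.sum_congr rfl fun c _ =>
            integral_bump hδ.pos.le (hδ.le c) (hδ.add_le c)
        · rw [intervalIntegrable_iff_integrableOn_Ioc_of_le zero_le_one]
          exact (integrable_const (1 : ℝ)).indicator measurableSet_Ioo
      have hαeq : (fun k => φ (a ^ k)) = fun k => φ₀ (a₀ ^ k) :=
        funext fun k => tendsto_nhds_unique (hα' k) (hα k)
      rw [hαeq, hint] at hM
      have := hfe A φ b a _ hM
      rw [Complex.ofReal_sum] at this
      rw [← this]
      exact hw n hn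
    -- The alternating sum over `U` is computed twice: the word moments give a sum over
    -- permutations, the polynomial gives its coefficient of degree `n`.
    have hsum : Tendsto (fun N => ∑ τ : Equiv.Perm (Fin n),
        wordMoment P (fun k => bump (x (τ k)) δ) N) atTop
        (𝓝 (n.factorial * (((2 * δ : ℝ) : ℂ) ^ n * f.coeff n))) := by
      rw [← sum_neg_one_pow_eval f hf]
      refine (tendsto_finsetSum _ fun U _ => (hlimU U).const_mul _).congr fun N => ?_
      exact sum_neg_one_pow_wordMoment (fun c => bump (x c) δ) N
    have hpos : 0 < (2 * δ) ^ n := by have := hδ.pos; positivity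
    have hle : ‖(n.factorial : ℂ) * (((2 * δ : ℝ) : ℂ) ^ n * f.coeff n) -
        ∑ τ : Equiv.Perm (Fin n), ((2 * δ : ℝ) : ℂ) ^ n * g n (fun k => x (τ k))‖ ≤
          n.factorial * (ε * (2 * δ) ^ n) := by
      refine le_of_tendsto (hsum.sub_const _).norm ?_
      filter_upwards [eventually_all.2 happ] with N hN
      rw [← Finset.sum_sub_distrib]
      refine (norm_sum_le _ _).trans ((Finset.sum_le_sum fun τ _ => hN τ).trans_eq ?_)
      rw [Finset.sum_const, Finset.card_univ, Fintype.card_perm, Fintype.card_fin, nsmul_eq_mul]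
    have hfac : (n.factorial : ℂ) * (((2 * δ : ℝ) : ℂ) ^ n * f.coeff n) -
        ∑ τ : Equiv.Perm (Fin n), ((2 * δ : ℝ) : ℂ) ^ n * g n (fun k => x (τ k)) =
        -((n.factorial : ℂ) * ((2 * δ : ℝ) : ℂ) ^ n * (symmetrize (g n) x - f.coeff n)) := by
      rw [← Finset.mul_sum, symmetrize]
      field_simp
      ring
    rw [hfac, norm_neg, norm_mul, norm_mul, norm_pow, Complex.norm_natCast, Complex.norm_real,
      Real.norm_of_nonneg (by linarith [hδ.pos] : 0 ≤ 2 * δ)] at hle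
    have hn0 : (0 : ℝ) < n.factorial := by exact_mod_cast n.factorial_pos
    refine le_of_mul_le_mul_left (a := (n.factorial : ℝ) * (2 * δ) ^ n) ?_ (by positivity)
    linarith
  refine ⟨f.coeff n, fun x hx => ?_⟩
  have hperm : ∀ (τ : Equiv.Perm (Fin n)), ContinuousOn (fun x : Fin n → ℝ =>
      g n (fun k => x (τ k))) (Set.Icc 0 1) := fun τ =>
    (hP.continuous n hn).comp (by fun_prop) fun x hx => ⟨fun k => hx.1 (τ k), fun k => hx.2 (τ k)⟩
  have hcont : ContinuousOn (fun x => symmetrize (g n) x - f.coeff n) (Set.Icc 0 1) := by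
    unfold symmetrize
    exact ((continuousOn_finsetSum _ fun τ _ => hperm τ).const_smul
      (n.factorial : ℂ)⁻¹).sub continuousOn_const
  exact sub_eq_zero.1 (eq_zero_of_genericCube hcont hgen hx)

theorem norm_sub_le_of_norm_sub_mul_le {δ ε : ℝ} (hδ : 0 < δ) {n : ℕ} {z w u v : ℂ}
    (hu : ‖z - ((2 * δ : ℝ) : ℂ) ^ n * u‖ ≤ ε / 2 * (2 * δ) ^ n)
    (hv : ‖w - ((2 * δ : ℝ) : ℂ) ^ n * v‖ ≤ ε / 2 * (2 * δ) ^ n) :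
    ‖v - u‖ * (2 * δ) ^ n ≤ ε * (2 * δ) ^ n + ‖z - w‖ := by
  have h1 : ‖v - u‖ * (2 * δ) ^ n = ‖((2 * δ : ℝ) : ℂ) ^ n * (v - u)‖ := by
    rw [norm_mul, norm_pow, Complex.norm_real, Real.norm_of_nonneg (by positivity), mul_comm]
  rw [h1, show ((2 * δ : ℝ) : ℂ) ^ n * (v - u) = (z - ((2 * δ : ℝ) : ℂ) ^ n * u) -
    (w - ((2 * δ : ℝ) : ℂ) ^ n * v) - (z - w) by ring]
  have h2 := norm_sub_le ((z - ((2 * δ : ℝ) : ℂ) ^ n * u) -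
    (w - ((2 * δ : ℝ) : ℂ) ^ n * v)) (z - w)
  have h3 := norm_sub_le (z - ((2 * δ : ℝ) : ℂ) ^ n * u) (w - ((2 * δ : ℝ) : ℂ) ^ n * v)
  linarith

/-! ### Freeness from the deterministic diagonal matrices -/

/-- At a generic point, the words attached to `x` and to its rotation have equal moments, and these
approximate `(2δ)^n` times the two values of `g n`. -/
theorem IsEnsemble.comp_finRotate (hP : IsEnsemble P g) {n : ℕ} (hn : 1 ≤ n) {x : Fin n → ℝ}
    (hx : x ∈ Set.Icc (0 : Fin n → ℝ) 1) : g n (fun k => x (finRotate n k)) = g n x := by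
  have hcont : ContinuousOn (fun x : Fin n → ℝ => g n (fun k => x (finRotate n k)) - g n x)
      (Set.Icc 0 1) :=
    ((hP.continuous n hn).comp (by fun_prop) fun x hx =>
      ⟨fun k => hx.1 (finRotate n k), fun k => hx.2 (finRotate n k)⟩).sub (hP.continuous n hn)
  refine sub_eq_zero.1 (eq_zero_of_genericCube hcont (fun x hx => ?_) hx)
  rw [← norm_le_zero_iff]
  refine le_of_forall_pos_le_add fun ε hε => ?_
  rw [zero_add]
  have hrot : (fun k => x (finRotate n k)) ∈ genericCube n :=
    ⟨hx.1.comp (finRotate n).injective, fun k => hx.2 _⟩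
  have hpos : ∀ᶠ δ in 𝓝[>] (0 : ℝ), 0 < δ := eventually_mem_nhdsWithin
  obtain ⟨δ, hδ, h1, h2⟩ := (hpos.and ((hP.wordMoment_bump hn hx (half_pos hε)).and
    (hP.wordMoment_bump hn hrot (half_pos hε)))).exists
  obtain ⟨N, h1, h2⟩ := (h1.and h2).exists
  rw [wordMoment_finRotate (fun k => bump (x k) δ)] at h2
  have h3 := norm_sub_le_of_norm_sub_mul_le hδ h1 h2
  rw [sub_self, norm_zero, add_zero] at h3
  exact le_of_mul_le_mul_right h3 (by positivity)

theorem secondLetters_flatten_ofFn {B : Type*} (a : B) {n : ℕ} (p : Fin n → B) :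
    secondLetters (List.ofFn fun k => [(false, p k), (true, a)]).flatten = List.ofFn p := by
  induction n with
  | zero => simp [secondLetters]
  | succ n ih =>
    rw [List.ofFn_succ, List.flatten_cons, List.cons_append, List.cons_append, List.nil_append,
      secondLetters_cons_false, secondLetters_cons_true, ih, List.ofFn_succ]

/-- Freeness from the diagonal matrices makes `g n` independent of its first argument. -/
theorem IsEnsemble.eq_of_generic (hP : IsEnsemble P g)
    (hfree : IsFreeFromDiagonal P {d | IsProfile d}) {m : ℕ} {s t : ℝ} {x : Fin m → ℝ}
    (hz : (Fin.cons s (Fin.cons t x : Fin (m + 1) → ℝ) : Fin (m + 2) → ℝ) ∈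
      genericCube (m + 2)) :
    g (m + 1) (Fin.cons s x) = g (m + 1) (Fin.cons t x) := by
  obtain ⟨A, _, _, φ, a, ι, h1, hfree, hlim⟩ := hfree
  set z : Fin (m + 2) → ℝ := Fin.cons s (Fin.cons t x : Fin (m + 1) → ℝ) with hz_def
  have hsx : (Fin.cons s x : Fin (m + 1) → ℝ) ∈ genericCube (m + 1) := by
    have : (Fin.cons s x : Fin (m + 1) → ℝ) = fun k => z (Fin.succAbove 1 k) := by
      funext k
      refine Fin.cases ?_ (fun k => ?_) k
      · simp [hz_def]
      · rw [Fin.cons_succ, Fin.one_succAbove_succ, hz_def, Fin.cons_succ, Fin.cons_succ]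
    rw [this]
    exact ⟨hz.1.comp Fin.succAbove_right_injective, fun k => hz.2 _⟩
  have htx : (Fin.cons t x : Fin (m + 1) → ℝ) ∈ genericCube (m + 1) := by
    have : (Fin.cons t x : Fin (m + 1) → ℝ) = fun k => z k.succ := by
      funext k; simp [hz_def]
    rw [this]
    exact ⟨hz.1.comp (Fin.succ_injective _), fun k => hz.2 _⟩
  rw [← sub_eq_zero, ← norm_le_zero_iff]
  refine le_of_forall_pos_le_add fun ε hε => ?_
  rw [zero_add]
  obtain ⟨δ, hδ, hs, ht⟩ := ((eventually_isSmallRadius hz).and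
    ((hP.wordMoment_bump (Nat.succ_pos m) hsx (half_pos hε)).and
      (hP.wordMoment_bump (Nat.succ_pos m) htx (half_pos hε)))).exists
  set p : ℝ → {d | IsProfile d} := fun c => ⟨bump c δ, isProfile_bump c δ⟩ with hp
  have hword : ∀ y : Fin (m + 1) → ℝ, Tendsto (wordMoment P fun k => bump (y k) δ) atTop
      (𝓝 (φ (List.ofFn fun k => ι (p (y k)) * a).prod)) := by
    intro y
    have h2 := hlim (List.ofFn fun k => [some (p (y k)), none]).flatten
    rw [prod_map_elim a ι fun k => p (y k)] at h2
    refine h2.congr fun N => ?_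
    simp only [prod_map_letterMat _ fun k => p (y k)]
    exact hP.integral_ntr_prod (Nat.succ_pos m) fun k => bump (y k) δ
  have hdiag : ∀ l : List {d | IsProfile d}, Tendsto
      (fun N : ℕ => (((N : ℝ)⁻¹ * ∑ i : Fin N, (l.map fun d => d.1 (site N i)).prod : ℝ) : ℂ))
      atTop (𝓝 (φ (l.map ι).prod)) := by
    intro l
    have h2 := hlim (l.map some)
    simp only [hP.integral_ntr_diag] at h2
    simpa only [List.map_map, Function.comp_def, Option.elim_some] using h2
  have hsingle : ∀ k, φ (ι (p (z k))) = ((2 * δ : ℝ) : ℂ) := by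
    intro k
    have h2 := hdiag [p (z k)]
    simp only [List.map_cons, List.map_nil, List.prod_singleton] at h2
    refine tendsto_nhds_unique h2 ?_
    have h3 := (Complex.continuous_ofReal.tendsto _).comp
      (isProfile_bump (z k) δ).tendsto_mean
    rwa [integral_bump hδ.pos.le (hδ.le k) (hδ.add_le k)] at h3
  -- The intervals are disjoint, so these traces already vanish for every `N`.
  have hpair : ∀ (k j : Fin (m + 2)), k ≠ j → ∀ l : List {d | IsProfile d},
      φ (ι (p (z k)) * (ι (p (z j)) * (l.map ι).prod)) = 0 := by
    intro k j hkj l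
    have h2 := hdiag (p (z k) :: p (z j) :: l)
    simp only [List.map_cons, List.prod_cons] at h2
    refine tendsto_nhds_unique h2 ?_
    have : ∀ (N : ℕ) (i : Fin N), (p (z k)).1 (site N i) * ((p (z j)).1 (site N i) *
        (l.map fun d => d.1 (site N i)).prod) = 0 := fun N i => by
      rw [← mul_assoc]
      exact mul_eq_zero_of_left (hδ.bump_mul hkj _) _
    simp only [this, Finset.sum_const_zero, mul_zero, Complex.ofReal_zero]
    exact tendsto_const_nhds
  have hmem : ∀ d, ι d ∈ Algebra.adjoin ℂ (Set.range ι) := fun d =>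
    Algebra.subset_adjoin ⟨d, rfl⟩
  set L : List (Bool × A) :=
    (true, a) :: (List.ofFn fun k => [(false, ι (p (x k))), (true, a)]).flatten with hL
  -- The empty sublist requires `φ(p_s) = φ(p_t)`, true because both intervals have length `2δ`. Any
  -- other sublist starts with some `p_{x_k}`, supported away from both intervals.
  have horth := hfree.orthogonal_word h1 L.length [] L (ι (p s) - ι (p t)) (by simp)
    (Subalgebra.sub_mem _ (hmem _) (hmem _))
    (by
      intro y hy
      simp only [hL, List.nil_append, List.mem_cons, List.mem_flatten, List.mem_ofFn] at hy
      rcases hy with rfl | ⟨l, ⟨k, rfl⟩, hy⟩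
      · exact Algebra.subset_adjoin rfl
      · simp only [List.mem_cons, List.not_mem_nil, or_false] at hy
        rcases hy with rfl | rfl
        · exact hmem _
        · exact Algebra.subset_adjoin rfl)
    (by simp)
    (by
      intro l hl
      rw [List.nil_append, hL, secondLetters_cons_true, secondLetters_flatten_ofFn,
        show (List.ofFn fun k => ι (p (x k))) = (List.ofFn fun k => p (x k)).map ι by
          rw [List.map_ofFn]; rfl, List.sublist_map_iff] at hl
      obtain ⟨l, hl, rfl⟩ := hl
      cases l with
      | nil =>
        have e1 := hsingle 0
        have e2 := hsingle 1
        simp only [hz_def, Fin.cons_zero, Fin.cons_one] at e1 e2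
        simp [e1, e2]
      | cons d l =>
        obtain ⟨k, rfl⟩ := List.mem_ofFn.1 (hl.subset List.mem_cons_self)
        have e1 := hpair 0 k.succ.succ (Fin.succ_ne_zero _).symm l
        have e2 := hpair 1 k.succ.succ (by simp [Fin.ext_iff]) l
        simp only [hz_def, Fin.cons_zero, Fin.cons_one, Fin.cons_succ] at e1 e2
        rw [List.map_cons, List.prod_cons, sub_mul, map_sub, e1, e2, sub_zero])
  have hprod : ∀ r, (List.ofFn fun k => ι (p ((Fin.cons r x : Fin (m + 1) → ℝ) k)) * a).prod =
      ι (p r) * (L.map Prod.snd).prod := by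
    intro r
    rw [List.ofFn_succ, List.prod_cons]
    simp only [hL, Fin.cons_zero, Fin.cons_succ, List.map_cons, List.prod_cons, List.map_flatten,
      List.prod_flatten, List.map_ofFn, Function.comp_def, List.map_nil, List.prod_nil, mul_one,
      mul_assoc]
  have hdiff : Tendsto (fun N => wordMoment P (fun k => bump ((Fin.cons t x : Fin (m + 1) → ℝ) k) δ) N -
      wordMoment P (fun k => bump ((Fin.cons s x : Fin (m + 1) → ℝ) k) δ) N) atTop (𝓝 0) := by
    have := (hword (Fin.cons t x)).sub (hword (Fin.cons s x))
    rw [hprod, hprod] at this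
    rw [List.nil_append, sub_mul, map_sub] at horth
    rwa [← neg_sub, horth, neg_zero] at this
  have hle : ‖g (m + 1) (Fin.cons s x) - g (m + 1) (Fin.cons t x)‖ * (2 * δ) ^ (m + 1) ≤
      ε * (2 * δ) ^ (m + 1) + ‖(0 : ℂ)‖ := by
    refine ge_of_tendsto (hdiff.norm.const_add _) ?_
    filter_upwards [hs, ht] with N hs ht
    exact norm_sub_le_of_norm_sub_mul_le hδ.pos ht hs
  rw [norm_zero, add_zero] at hle
  have := hδ.pos
  exact le_of_mul_le_mul_right hle (by positivity)

theorem IsEnsemble.eq_of_cube (hP : IsEnsemble P g)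
    (hfree : IsFreeFromDiagonal P {d | IsProfile d}) {m : ℕ} {s t : ℝ} {x : Fin m → ℝ}
    (hs : s ∈ Set.Icc (0 : ℝ) 1) (ht : t ∈ Set.Icc (0 : ℝ) 1)
    (hx : x ∈ Set.Icc (0 : Fin m → ℝ) 1) :
    g (m + 1) (Fin.cons s x) = g (m + 1) (Fin.cons t x) := by
  -- Both sides are viewed as functions of `z = (s, t, x)` in the cube of dimension `m + 2`, where
  -- the generic points are dense.
  have hmap : ∀ j : Fin (m + 2), ContinuousOn (fun z : Fin (m + 2) → ℝ =>
      g (m + 1) (Fin.cons (z j) fun k => z k.succ.succ)) (Set.Icc 0 1) := by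
    intro j
    refine (hP.continuous (m + 1) (Nat.succ_pos m)).comp ?_ fun z hz => ?_
    · refine (continuous_pi fun k => ?_).continuousOn
      refine Fin.cases ?_ (fun k => ?_) k
      · simpa using continuous_apply j
      · simpa using continuous_apply k.succ.succ
    · refine ⟨fun k => ?_, fun k => ?_⟩
      · refine Fin.cases ?_ (fun k => ?_) k
        · simpa using hz.1 j
        · simpa using hz.1 k.succ.succ
      · refine Fin.cases ?_ (fun k => ?_) k
        · simpa using hz.2 j
        · simpa using hz.2 k.succ.succ
  have h := eq_zero_of_genericCube ((hmap 0).sub (hmap 1)) (fun z hz => by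
    refine sub_eq_zero.2 (hP.eq_of_generic hfree ?_)
    convert hz
    funext k
    refine Fin.cases rfl (fun k => ?_) k
    rw [Fin.cons_succ]
    exact Fin.cases rfl (fun k => by rw [Fin.cons_succ]) k)
    (x := Fin.cons s (Fin.cons t x : Fin (m + 1) → ℝ))
    ⟨fun k => by
      refine Fin.cases hs.1 (fun k => ?_) k
      exact Fin.cases ht.1 (fun k => hx.1 k) k,
    fun k => by
      refine Fin.cases hs.2 (fun k => ?_) k
      exact Fin.cases ht.2 (fun k => hx.2 k) k⟩
  exact sub_eq_zero.1 h

theorem IsEnsemble.const_of_free (hP : IsEnsemble P g)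
    (hfree : IsFreeFromDiagonal P {d | IsProfile d}) {n : ℕ} (hn : 1 ≤ n) :
    IsConstOnCube (g n) := by
  obtain ⟨m, rfl⟩ := Nat.exists_eq_succ_of_ne_zero (Nat.one_le_iff_ne_zero.1 hn)
  -- Induction on the number `c` of initial coordinates that may be nonzero: the first one is
  -- replaced by `0`, and a rotation sends it to the last place and shifts the others down.
  have key : ∀ c : ℕ, ∀ y ∈ Set.Icc (0 : Fin (m + 1) → ℝ) 1,
      (∀ k : Fin (m + 1), c ≤ k → y k = 0) → g (m + 1) y = g (m + 1) 0 := by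
    intro c
    induction c with
    | zero =>
      intro y _ h
      congr 1
      exact funext fun k => h k (Nat.zero_le _)
    | succ c ih =>
      intro y hy h
      set y' : Fin (m + 1) → ℝ := Fin.cons 0 (Fin.tail y) with hy'
      have hy'mem : y' ∈ Set.Icc (0 : Fin (m + 1) → ℝ) 1 :=
        ⟨fun k => Fin.cases le_rfl (fun k => hy.1 k.succ) k,
          fun k => Fin.cases zero_le_one (fun k => hy.2 k.succ) k⟩
      have h1 : g (m + 1) y = g (m + 1) y' := by
        conv_lhs => rw [← Fin.cons_self_tail y]
        exact hP.eq_of_cube hfree ⟨hy.1 0, hy.2 0⟩ ⟨le_rfl, zero_le_one⟩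
          ⟨fun k => hy.1 k.succ, fun k => hy.2 k.succ⟩
      rw [h1, ← hP.comp_finRotate (Nat.succ_pos m) hy'mem]
      refine ih _ ⟨fun k => hy'mem.1 (finRotate (m + 1) k),
        fun k => hy'mem.2 (finRotate (m + 1) k)⟩ fun k hk => ?_
      induction k using Fin.lastCases with
      | last => rw [finRotate_last]; rfl
      | cast j =>
        rw [finRotate_apply, Fin.coeSucc_eq_succ, hy', Fin.cons_succ, Fin.tail]
        exact h _ (by simpa using hk)
  exact ⟨_, fun x hx => key (m + 1) x hx fun k hk => absurd k.2 (not_lt.2 hk)⟩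

end NotFree

/-! ### The first two moments of `M_h` -/

theorem tendsto_average_of_uniform {f F : ∀ N : ℕ, Fin N → ℂ} {L : ℂ}
    (h : ∀ ε : ℝ, 0 < ε → ∀ᶠ N in atTop, ∀ i, ‖f N i - F N i‖ ≤ ε)
    (hF : Tendsto (fun N : ℕ => (N : ℂ)⁻¹ * ∑ i, F N i) atTop (𝓝 L)) :
    Tendsto (fun N : ℕ => (N : ℂ)⁻¹ * ∑ i, f N i) atTop (𝓝 L) := by
  have h0 : Tendsto (fun N : ℕ => (N : ℂ)⁻¹ * ∑ i, f N i - (N : ℂ)⁻¹ * ∑ i, F N i) atTop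
      (𝓝 0) := by
    rw [Metric.tendsto_nhds]
    intro ε hε
    filter_upwards [h (ε / 2) (half_pos hε), eventually_gt_atTop 0] with N hN hN0
    have hN0' : (0 : ℝ) < N := by exact_mod_cast hN0
    rw [dist_zero_right, ← mul_sub, ← Finset.sum_sub_distrib, norm_mul, norm_inv,
      Complex.norm_natCast]
    have h1 : ‖∑ i, (f N i - F N i)‖ ≤ N * (ε / 2) := by
      refine (norm_sum_le _ _).trans ((Finset.sum_le_sum fun i _ => hN i).trans_eq ?_)
      simp
    calc (N : ℝ)⁻¹ * ‖∑ i, (f N i - F N i)‖ ≤ (N : ℝ)⁻¹ * (N * (ε / 2)) := by gcongr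
      _ = ε / 2 := by field_simp
      _ < ε := half_lt_self hε
  simpa using h0.add hF

section Moments

variable {P : ∀ N : ℕ, Measure (Fin N → Fin N → ℂ)} {g : ∀ n : ℕ, (Fin n → ℝ) → ℂ}

theorem IsEnsemble.exists_bound (hP : IsEnsemble P g) {n : ℕ} (hn : 1 ≤ n) :
    ∃ G : ℝ, 0 ≤ G ∧ ∀ x ∈ Set.Icc (0 : Fin n → ℝ) 1, ‖g n x‖ ≤ G := by
  obtain ⟨G, hG⟩ := isCompact_Icc.exists_bound_of_continuousOn (hP.continuous n hn)
  exact ⟨max G 0, le_max_right _ _, fun x hx => (hG x hx).trans (le_max_left _ _)⟩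

theorem IsProfile.exists_norm_bound {h : ℝ → ℝ} (hh : IsProfile h) :
    ∃ C : ℝ, 0 ≤ C ∧ ∀ x ∈ Set.Icc (0 : ℝ) 1, ‖(h x : ℂ)‖ ≤ C := by
  obtain ⟨C, hC⟩ := hh.bounded
  exact ⟨max C 0, le_max_right _ _, fun x hx => by
    rw [Complex.norm_real]; exact (hC x hx).trans (le_max_left _ _)⟩

theorem vec_one_mem {x : ℝ} (hx : x ∈ Set.Icc (0 : ℝ) 1) :
    ![x] ∈ Set.Icc (0 : Fin 1 → ℝ) 1 :=
  ⟨fun k => by simpa using hx.1, fun k => by simpa using hx.2⟩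

theorem vec_two_mem {x y : ℝ} (hx : x ∈ Set.Icc (0 : ℝ) 1) (hy : y ∈ Set.Icc (0 : ℝ) 1) :
    ![x, y] ∈ Set.Icc (0 : Fin 2 → ℝ) 1 :=
  ⟨Fin.forall_fin_two.2 ⟨by simpa using hx.1, by simpa using hy.1⟩,
    Fin.forall_fin_two.2 ⟨by simpa using hx.2, by simpa using hy.2⟩⟩

theorem IsEnsemble.continuousOn_one (hP : IsEnsemble P g) :
    ContinuousOn (fun x : ℝ => g 1 ![x]) (Set.Icc 0 1) :=
  (hP.continuous 1 le_rfl).comp (by fun_prop) fun _ hx => vec_one_mem hx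

theorem IsEnsemble.continuousOn_two (hP : IsEnsemble P g) :
    ContinuousOn (fun p : ℝ × ℝ => g 2 ![p.1, p.2]) (Set.Icc 0 1 ×ˢ Set.Icc 0 1) :=
  (hP.continuous 2 one_le_two).comp (by fun_prop) fun _ hp => vec_two_mem hp.1 hp.2

theorem loop_one {N : ℕ} (i : Fin 1 → Fin N) (A : Fin N → Fin N → ℂ) :
    loop i A = A (i 0) (i 0) := by
  simp [loop, loopEntry]

theorem loop_two {N : ℕ} (i : Fin 2 → Fin N) (A : Fin N → Fin N → ℂ) :
    loop i A = A (i 0) (i 1) * A (i 1) (i 0) := by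
  simp [loop, loopEntry, Fin.prod_univ_two, finRotate_apply]

theorem wordMoment_one (h : ℝ → ℝ) (N : ℕ) :
    wordMoment P (fun _ : Fin 1 => h) N =
      (N : ℂ)⁻¹ * ∑ a : Fin N, (h (site N a) : ℂ) * ∫ A, A a a ∂P N := by
  rw [wordMoment, ← (Equiv.funUnique (Fin 1) (Fin N)).symm.sum_comp]
  simp [loop_one]

theorem wordMoment_two (h : ℝ → ℝ) (N : ℕ) :
    wordMoment P (fun _ : Fin 2 => h) N =
      (N : ℂ)⁻¹ * ∑ a : Fin N, ∑ b : Fin N,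
        (h (site N a) : ℂ) * h (site N b) * ∫ A, A a b * A b a ∂P N := by
  rw [wordMoment, ← (finTwoArrowEquiv (Fin N)).symm.sum_comp, Fintype.sum_prod_type]
  simp [loop_two, Fin.prod_univ_two]

theorem IsEnsemble.limit_diag (hP : IsEnsemble P g) {ε : ℝ} (hε : 0 < ε) :
    ∀ᶠ N in atTop, ∀ a : Fin N, ‖∫ A, A a a ∂P N - g 1 ![site N a]‖ < ε := by
  filter_upwards [hP.limit_loop le_rfl hε] with N hN a
  have := hN (fun _ => a) (Function.injective_of_subsingleton _)
  simp only [loop_one, Nat.sub_self, pow_zero, one_mul] at this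
  convert this using 4
  exact funext fun k => by simp

theorem IsEnsemble.limit_offDiag (hP : IsEnsemble P g) {ε : ℝ} (hε : 0 < ε) :
    ∀ᶠ N in atTop, ∀ a b : Fin N, a ≠ b →
      ‖(N : ℂ) * ∫ A, A a b * A b a ∂P N - g 2 ![site N a, site N b]‖ < ε := by
  filter_upwards [hP.limit_loop one_le_two hε] with N hN a b hab
  have := hN ![a, b] (by
    intro k j hkj
    fin_cases k <;> fin_cases j <;> simp_all)
  simp only [loop_two, Nat.reduceSub, pow_one, Matrix.cons_val_zero, Matrix.cons_val_one] at this
  convert this using 4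
  exact funext fun k => by fin_cases k <;> rfl

/-- By factorization, `𝔼[M_{ii}²]` is close to `g₁(i / N)²`. -/
theorem IsEnsemble.limit_diag_sq (hP : IsEnsemble P g) {ε : ℝ} (hε : 0 < ε) :
    ∀ᶠ N in atTop, ∀ a : Fin N, ‖∫ A, A a a * A a a ∂P N - g 1 ![site N a] ^ 2‖ < ε := by
  obtain ⟨C, hC⟩ := hP.factorization 1 1 le_rfl le_rfl
  obtain ⟨G, hG0, hG⟩ := hP.exists_bound le_rfl
  have hlim : Tendsto (fun N : ℕ => C / N) atTop (𝓝 0) := tendsto_const_div_atTop_nhds_zero_nat C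
  -- With `e` within `η` of `g₁` and `‖g₁‖ ≤ G`, one has `‖e² - g₁²‖ ≤ η (1 + 2G)`, which is at most
  -- `ε / 2`. Factorization contributes the remaining error `C / N`.
  have hη : 0 < min 1 (ε / (4 * (G + 1))) := by positivity
  filter_upwards [hlim.eventually_lt_const (half_pos hε), hP.limit_diag hη,
    eventually_gt_atTop 0] with N hN hdiag hN0 a
  have hN0' : (0 : ℝ) < N := by exact_mod_cast hN0
  have h1 := hC N (fun _ => a) (fun _ => a) (Function.injective_of_subsingleton _)
    (Function.injective_of_subsingleton _) (fun x y _ => by simp)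
  simp only [loop_one, Nat.reduceAdd, Nat.reduceSub, pow_one] at h1
  rw [mul_comm, ← le_div_iff₀ hN0'] at h1
  set e := ∫ A, A a a ∂P N
  have h2 := hdiag a
  have h3 := hG ![site N a] (vec_one_mem (site_mem N a))
  have h4 : ‖e * e - g 1 ![site N a] ^ 2‖ ≤ ε / 2 := by
    rw [show e * e - g 1 ![site N a] ^ 2 =
      (e - g 1 ![site N a]) * ((e - g 1 ![site N a]) + 2 * g 1 ![site N a]) by ring, norm_mul]
    have h5 : ‖(e - g 1 ![site N a]) + 2 * g 1 ![site N a]‖ ≤ 1 + 2 * G := by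
      refine (norm_add_le _ _).trans (add_le_add (h2.le.trans (min_le_left _ _)) ?_)
      rw [norm_mul, RCLike.norm_ofNat]
      gcongr
    calc _ ≤ ε / (4 * (G + 1)) * (1 + 2 * G) :=
          mul_le_mul (h2.le.trans (min_le_right _ _)) h5 (norm_nonneg _) (by positivity)
      _ ≤ ε / 2 := by
          rw [div_mul_eq_mul_div, div_le_div_iff₀ (by positivity) two_pos]
          nlinarith
  have h6 := norm_sub_le_norm_sub_add_norm_sub (∫ A, A a a * A a a ∂P N) (e * e)
    (g 1 ![site N a] ^ 2)
  linarith

theorem IsEnsemble.tendsto_wordMoment_one (hP : IsEnsemble P g) {h : ℝ → ℝ} (hh : IsProfile h) :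
    Tendsto (wordMoment P fun _ : Fin 1 => h) atTop (𝓝 (mean₁ g h)) := by
  obtain ⟨C, hC0, hC⟩ := hh.exists_norm_bound
  obtain ⟨G, hG0, hG⟩ := hP.exists_bound le_rfl
  simp only [funext (wordMoment_one (P := P) h)]
  refine tendsto_average_of_uniform
    (F := fun N a => (h (site N a) : ℂ) * g 1 ![site N a]) (fun ε hε => ?_) ?_
  · filter_upwards [hP.limit_diag (ε := ε / (C + 1)) (by positivity)] with N hN a
    rw [← mul_sub, norm_mul]
    calc _ ≤ C * (ε / (C + 1)) :=
          mul_le_mul (hC _ (site_mem N a)) (hN a).le (norm_nonneg _) hC0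
      _ ≤ ε := by
          rw [mul_div_assoc', div_le_iff₀ (by positivity)]; nlinarith
  · refine tendsto_riemann_sum (f := fun x => (h x : ℂ) * g 1 ![x]) (C := C * G)
      (fun x hx => ?_) ?_
    · rw [norm_mul]
      exact mul_le_mul (hC x hx) (hG _ (vec_one_mem hx)) (norm_nonneg _) hC0
    · filter_upwards [hh.ae_continuous, ae_restrict_mem measurableSet_Icc] with x hx hx01
      exact (Complex.continuous_ofReal.continuousAt.comp_continuousWithinAt hx).mul
        (hP.continuousOn_one x hx01)

theorem IsEnsemble.tendsto_diag_sum (hP : IsEnsemble P g) {h : ℝ → ℝ} (hh : IsProfile h) :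
    Tendsto (fun N : ℕ => (N : ℂ)⁻¹ * ∑ a : Fin N,
      (h (site N a) : ℂ) * h (site N a) * ∫ A, A a a * A a a ∂P N) atTop
      (𝓝 (meanSq₁ g h)) := by
  obtain ⟨C, hC0, hC⟩ := hh.exists_norm_bound
  obtain ⟨G, hG0, hG⟩ := hP.exists_bound le_rfl
  refine tendsto_average_of_uniform
    (F := fun N a => ((h (site N a) : ℂ) * g 1 ![site N a]) ^ 2) (fun ε hε => ?_) ?_
  · filter_upwards [hP.limit_diag_sq (ε := ε / (C * C + 1)) (by positivity)] with N hN a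
    rw [mul_pow, sq (h (site N a) : ℂ), ← mul_sub, norm_mul, norm_mul]
    have h1 := hC _ (site_mem N a)
    calc _ ≤ C * C * (ε / (C * C + 1)) :=
          mul_le_mul (mul_le_mul h1 h1 (norm_nonneg _) hC0) (hN a).le (norm_nonneg _)
            (by positivity)
      _ ≤ ε := by
          rw [mul_div_assoc', div_le_iff₀ (by positivity)]; nlinarith
  · refine tendsto_riemann_sum (f := fun x => ((h x : ℂ) * g 1 ![x]) ^ 2) (C := (C * G) ^ 2)
      (fun x hx => ?_) ?_
    · rw [norm_pow, norm_mul]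
      gcongr
      · exact hC x hx
      · exact hG _ (vec_one_mem hx)
    · filter_upwards [hh.ae_continuous, ae_restrict_mem measurableSet_Icc] with x hx hx01
      exact ((Complex.continuous_ofReal.continuousAt.comp_continuousWithinAt hx).mul
        (hP.continuousOn_one x hx01)).pow 2

/-- For `a ≠ b` the expectation of `M_ab M_ba` is of order `1 / N`, whence the factor `N`. Setting
the diagonal terms to zero changes each inner average by at most `G C² / N`. -/
theorem IsEnsemble.tendsto_offDiag_sum (hP : IsEnsemble P g) {h : ℝ → ℝ} (hh : IsProfile h) :
    Tendsto (fun N : ℕ => (N : ℂ)⁻¹ * ∑ a : Fin N, (N : ℂ)⁻¹ * ∑ b : Fin N,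
      if a = b then 0 else
        (N : ℂ) * ((h (site N a) : ℂ) * h (site N b) * ∫ A, A a b * A b a ∂P N)) atTop
      (𝓝 (mean₂ g h)) := by
  obtain ⟨C, hC0, hC⟩ := hh.exists_norm_bound
  obtain ⟨G, hG0, hG⟩ := hP.exists_bound one_le_two
  have hbound : ∀ x ∈ Set.Icc (0 : ℝ) 1, ∀ y ∈ Set.Icc (0 : ℝ) 1,
      ‖g 2 ![x, y] * (h x : ℂ) * (h y : ℂ)‖ ≤ G * C * C := fun x hx y hy => by
    rw [norm_mul, norm_mul]
    exact mul_le_mul (mul_le_mul (hG _ (vec_two_mem hx hy)) (hC x hx) (norm_nonneg _) hG0)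
      (hC y hy) (norm_nonneg _) (by positivity)
  refine tendsto_average_of_uniform (F := fun N a => (N : ℂ)⁻¹ * ∑ b : Fin N,
    g 2 ![site N a, site N b] * (h (site N a) : ℂ) * (h (site N b) : ℂ)) (fun ε hε => ?_) ?_
  · have hlim : Tendsto (fun N : ℕ => G * C * C / N) atTop (𝓝 0) :=
      tendsto_const_div_atTop_nhds_zero_nat _
    filter_upwards [hP.limit_offDiag (ε := ε / 2 / (C * C + 1)) (by positivity),
      hlim.eventually_lt_const (half_pos hε), eventually_gt_atTop 0] with N hN hN' hN0 a
    have hN0' : (0 : ℝ) < N := by exact_mod_cast hN0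
    rw [← mul_sub, ← Finset.sum_sub_distrib, norm_mul, norm_inv, Complex.norm_natCast]
    have hterm : ∀ b : Fin N, ‖(if a = b then 0 else
        (N : ℂ) * ((h (site N a) : ℂ) * h (site N b) * ∫ A, A a b * A b a ∂P N)) -
          g 2 ![site N a, site N b] * (h (site N a) : ℂ) * (h (site N b) : ℂ)‖ ≤
        (if a = b then G * C * C else 0) + ε / 2 := by
      intro b
      split_ifs with hab
      · rw [zero_sub, norm_neg]
        have := hbound _ (site_mem N a) _ (site_mem N b)
        linarith
      · rw [show (N : ℂ) * ((h (site N a) : ℂ) * h (site N b) * ∫ A, A a b * A b a ∂P N) -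
          g 2 ![site N a, site N b] * (h (site N a) : ℂ) * (h (site N b) : ℂ) =
          (h (site N a) : ℂ) * h (site N b) *
            ((N : ℂ) * (∫ A, A a b * A b a ∂P N) - g 2 ![site N a, site N b]) by ring,
          norm_mul, norm_mul, zero_add]
        calc _ ≤ C * C * (ε / 2 / (C * C + 1)) :=
              mul_le_mul (mul_le_mul (hC _ (site_mem N a)) (hC _ (site_mem N b))
                (norm_nonneg _) hC0) (hN a b hab).le (norm_nonneg _) (by positivity)
          _ ≤ ε / 2 := by
              rw [mul_div_assoc', div_le_iff₀ (by positivity)]; nlinarith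
    have hsum : ‖∑ b : Fin N, ((if a = b then 0 else
        (N : ℂ) * ((h (site N a) : ℂ) * h (site N b) * ∫ A, A a b * A b a ∂P N)) -
          g 2 ![site N a, site N b] * (h (site N a) : ℂ) * (h (site N b) : ℂ))‖ ≤
        G * C * C + N * (ε / 2) := by
      refine (norm_sum_le _ _).trans ((Finset.sum_le_sum fun b _ => hterm b).trans_eq ?_)
      rw [Finset.sum_add_distrib]
      simp
    calc _ ≤ (N : ℝ)⁻¹ * (G * C * C + N * (ε / 2)) := by gcongr
      _ = G * C * C / N + ε / 2 := by field_simp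
      _ ≤ ε := by linarith
  · refine tendsto_riemann_sum₂ (F := fun x y => g 2 ![x, y] * (h x : ℂ) * (h y : ℂ)) hbound ?_
    filter_upwards [hh.ae_continuous, ae_restrict_mem measurableSet_Icc] with x hx hx01
    filter_upwards [hh.ae_continuous, ae_restrict_mem measurableSet_Icc] with y hy hy01
    have h1 : ContinuousWithinAt (fun p : ℝ × ℝ => (h p.1 : ℂ))
        (Set.Icc 0 1 ×ˢ Set.Icc 0 1) (x, y) :=
      Complex.continuous_ofReal.continuousAt.comp_continuousWithinAt
        (ContinuousWithinAt.comp (f := Prod.fst) hx continuousWithinAt_fst fun p hp => hp.1)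
    have h2 : ContinuousWithinAt (fun p : ℝ × ℝ => (h p.2 : ℂ))
        (Set.Icc 0 1 ×ˢ Set.Icc 0 1) (x, y) :=
      Complex.continuous_ofReal.continuousAt.comp_continuousWithinAt
        (ContinuousWithinAt.comp (f := Prod.snd) hy continuousWithinAt_snd fun p hp => hp.2)
    exact ((hP.continuousOn_two (x, y) ⟨hx01, hy01⟩).mul h1).mul h2

/-- The `N` diagonal terms of order one and the roughly `N²` off-diagonal terms of order `1 / N`
contribute at the same scale. -/
theorem IsEnsemble.tendsto_wordMoment_two (hP : IsEnsemble P g) {h : ℝ → ℝ} (hh : IsProfile h) :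
    Tendsto (wordMoment P fun _ : Fin 2 => h) atTop (𝓝 (meanSq₁ g h + mean₂ g h)) := by
  refine ((hP.tendsto_diag_sum hh).add (hP.tendsto_offDiag_sum hh)).congr' ?_
  filter_upwards [eventually_gt_atTop 0] with N hN0
  have hN : (N : ℂ) ≠ 0 := by exact_mod_cast hN0.ne'
  rw [wordMoment_two, ← mul_add, ← Finset.sum_add_distrib]
  congr 1
  refine Finset.sum_congr rfl fun a _ => ?_
  rw [Finset.mul_sum, ← Finset.add_sum_erase _ _ (Finset.mem_univ a),
    ← Finset.add_sum_erase Finset.univ (fun b => (h (site N a) : ℂ) * h (site N b) *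
      ∫ A, A a b * A b a ∂P N) (Finset.mem_univ a)]
  simp only [if_true, mul_zero, zero_add]
  congr 1
  refine Finset.sum_congr rfl fun b hb => ?_
  rw [if_neg (Finset.ne_of_mem_erase hb).symm, inv_mul_cancel_left₀ hN]

theorem IsEnsemble.spectral_moment_one (hP : IsEnsemble P g) {h : ℝ → ℝ}
    (hh : IsNonnegProfile h) {σ : Measure ℝ} (hσ : IsSpectralMeasure P h σ) :
    ((∫ t, t ^ 1 ∂σ : ℝ) : ℂ) = mean₁ g h :=
  tendsto_nhds_unique (hσ 1).2 ((hP.tendsto_wordMoment_one hh.1).congr fun _ =>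
    (hP.integral_ntr_compressed le_rfl hh.2).symm)

theorem IsEnsemble.spectral_moment_two (hP : IsEnsemble P g) {h : ℝ → ℝ}
    (hh : IsNonnegProfile h) {σ : Measure ℝ} (hσ : IsSpectralMeasure P h σ) :
    ((∫ t, t ^ 2 ∂σ : ℝ) : ℂ) = meanSq₁ g h + mean₂ g h :=
  tendsto_nhds_unique (hσ 2).2 ((hP.tendsto_wordMoment_two hh.1).congr fun _ =>
    (hP.integral_ntr_compressed one_le_two hh.2).symm)

end Moments

theorem IsProfile.intervalIntegrable {h : ℝ → ℝ} (hh : IsProfile h) :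
    IntervalIntegrable h volume 0 1 := by
  obtain ⟨C, hC⟩ := hh.bounded
  rw [intervalIntegrable_iff_integrableOn_Ioc_of_le zero_le_one]
  refine Measure.integrableOn_of_bounded (M := C) (by simp)
    hh.measurable.aestronglyMeasurable ?_
  exact (ae_restrict_iff' measurableSet_Ioc).2 (Eventually.of_forall fun x hx =>
    hC x (Set.Ioc_subset_Icc_self hx))

/-- A nonnegative `h` of zero integral vanishes almost everywhere. This gives `ν` a nonzero first
moment, so that `S_h` exists. -/
theorem integral_ne_zero_of_mean₁_ne_zero {g : ∀ n : ℕ, (Fin n → ℝ) → ℂ} {h : ℝ → ℝ}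
    (hh : IsNonnegProfile h) (hm : mean₁ g h ≠ 0) : ∫ x in (0 : ℝ)..1, h x ≠ 0 := by
  intro h0
  rw [intervalIntegral.integral_eq_zero_iff_of_le_of_nonneg_ae zero_le_one
    ((ae_restrict_iff' measurableSet_Ioc).2 (Eventually.of_forall fun x hx =>
      hh.2 x (Set.Ioc_subset_Icc_self hx))) hh.1.intervalIntegrable] at h0
  refine hm ?_
  rw [mean₁, intervalIntegral.integral_of_le zero_le_one]
  refine integral_eq_zero_of_ae ?_
  filter_upwards [h0] with x hx
  simp [hx]

end StructuredRM

end

/-! ### The main theorem -/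

theorem mainTheorem6
    (P : ∀ N : ℕ, Measure (Fin N → Fin N → ℂ)) (g : ∀ n : ℕ, (Fin n → ℝ) → ℂ)
    (hP : IsEnsemble P g) :
    -- the series `z₀ / z_I`, its expansion to first order, and what `S_I = S_h S₀` would force
    (∀ (h : ℝ → ℝ) (σ σI : Measure ℝ), IsNonnegProfile h →
      IsSpectralMeasure P (fun _ => 1) σ → IsSpectralMeasure P h σI →
      mean₁ g (fun _ => 1) ≠ 0 → mean₁ g h ≠ 0 →
      ∃ u₀ uI S₀ SI Sh q : ℂ⟦X⟧,
        -- `u₀ = 1 / z₀`, `uI = 1 / z_I`, the `S`-transforms, and `q = z₀ / z_I`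
        (∀ u, IsInvZ σ u ↔ u = u₀) ∧ (∀ u, IsInvZ σI u ↔ u = uI) ∧
        (∀ S, IsSTransform σ S ↔ S = S₀) ∧ (∀ S, IsSTransform σI S ↔ S = SI) ∧
        (∀ S, IsSTransform (profileLaw h) S ↔ S = Sh) ∧
        (∀ p, p * u₀ = uI ↔ p = q) ∧
        PowerSeries.coeff 0 q = mean₁ g (fun _ => 1) / mean₁ g h ∧
        PowerSeries.coeff 1 q = mean₁ g (fun _ => 1) / mean₁ g h *
          (-(meanSq₁ g h / mean₁ g h ^ 2
              - meanSq₁ g (fun _ => 1) / mean₁ g (fun _ => 1) ^ 2)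
            - (mean₂ g h / mean₁ g h ^ 2
              - mean₂ g (fun _ => 1) / mean₁ g (fun _ => 1) ^ 2)) ∧
        (SI = Sh * S₀ ↔ q = Sh) ∧
        (SI = Sh * S₀ →
          mean₁ g h = ((∫ x in (0 : ℝ)..1, h x : ℝ) : ℂ) * mean₁ g (fun _ => 1) ∧
          (meanSq₁ g h / mean₁ g h ^ 2
              - meanSq₁ g (fun _ => 1) / mean₁ g (fun _ => 1) ^ 2)
            + (mean₂ g h / mean₁ g h ^ 2
              - mean₂ g (fun _ => 1) / mean₁ g (fun _ => 1) ^ 2) =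
            ((((∫ x in (0 : ℝ)..1, h x ^ 2) - (∫ x in (0 : ℝ)..1, h x) ^ 2) /
              (∫ x in (0 : ℝ)..1, h x) ^ 2 : ℝ) : ℂ))) ∧
    -- the spectral measure of `M_h` is not the free multiplicative convolution
    ((∃ n, 1 ≤ n ∧ ¬ IsConstOnCube (symmetrize (g n))) →
      ∃ h : ℝ → ℝ, IsNonnegProfile h ∧
        (∀ σ σI : Measure ℝ, IsSpectralMeasure P (fun _ => 1) σ → IsSpectralMeasure P h σI →
          ¬ IsFreeMulConv (profileLaw h) σ σI) ∧
        ¬ IsFreeFromDiagonal P {h}) ∧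
    -- `M` is not free from the deterministic diagonal matrices
    ((∃ n, 1 ≤ n ∧ ¬ IsConstOnCube (g n)) →
      ¬ IsFreeFromDiagonal P {d | IsProfile d}) := by
  refine ⟨fun h σ σI hh hσ hσI hm₀ hm => ?_, fun hg => ?_, fun hg hfree => ?_⟩
  · have h1 : IsNonnegProfile fun _ => (1 : ℝ) := ⟨isProfile_const 1, fun _ _ => zero_le_one⟩
    have hne : ∫ x in (0 : ℝ)..1, h x ≠ 0 := integral_ne_zero_of_mean₁_ne_zero hh hm
    have hneC : ((∫ x in (0 : ℝ)..1, h x : ℝ) : ℂ) ≠ 0 := Complex.ofReal_ne_zero.2 hne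
    obtain ⟨u₀, uI, S₀, SI, Sh, q, e1, e2, e3, e4, e5, e6, e7, e8, e9, e10⟩ :=
      exists_series_quotient σ σI (profileLaw h)
        (hP.spectral_moment_one h1 hσ) (hP.spectral_moment_two h1 hσ)
        (hP.spectral_moment_one hh hσI) (hP.spectral_moment_two hh hσI)
        (c₁ := ((∫ x in (0 : ℝ)..1, h x : ℝ) : ℂ))
        (c₂ := ((∫ x in (0 : ℝ)..1, h x ^ 2 : ℝ) : ℂ))
        (by rw [integral_pow_profileLaw hh.1]; simp only [pow_one])
        (by rw [integral_pow_profileLaw hh.1]) hm₀ hm hneC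
    refine ⟨u₀, uI, S₀, SI, Sh, q, e1, e2, e3, e4, e5, e6, e7, ?_, e9, fun hS => ?_⟩
    · rw [e8]; ring
    · obtain ⟨f1, f2⟩ := e10 hS
      refine ⟨f1, ?_⟩
      push_cast
      rw [sub_div, div_self (pow_ne_zero 2 hneC), ← f2]
      ring
  -- If no profile works, then for each `h` either some pair of spectral measures satisfies the free
  -- convolution identity or `M` is free from `h`, which is the alternative that `symmetrize_const`
  -- takes as input.
  · by_contra! H
    obtain ⟨n, hn, hng⟩ := hg
    refine hng (hP.symmetrize_const (fun h hh => ?_) hn)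
    by_contra hno
    rw [not_or] at hno
    exact hno.2 (H h hh fun σ σI hσ hσI hfc => hno.1 ⟨σ, σI, hσ, hσI, hfc⟩)
  · obtain ⟨n, hn, hng⟩ := hg
    exact hng (hP.const_of_free hfree hn)
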